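/- Let $G$ be a finite connected multigraph (self-loops allowed) with edge set $E$, arbitrarily oriented, let $d\ge 1$ be an integer, and let $(s_0,s_1)_{s\in S}$ be a finite family of pairs of edges. For Schwinger parameters $a=(a_e)_{e\in E}$, let $B$ be the incidence matrix of $G$ (rows indexed by edges) with the column of one vertex removed, let $$M_G=\begin{pmatrix}\operatorname{diag}(a)&B\\-B^{T}&0\end{pmatrix},\qquad U=\det M_G .$$ For families $I,J$ of edges with the same index set, let $U^{I,J}$ be the determinant of the matrix obtained from $M_G$ by replacing, for every index $t$, the row of the edge $I(t)$ by the row whose only nonzero entry is a $1$ in the column of the edge $J(t)$; put $U^{I,J}=0$ if $I$ repeats an edge. For $S_0\subseteq S$ let $U^{S_0}$ be the mean of $U^{\varepsilon(S_0),\tilde\varepsilon(S_0)}$ over the $2^{\#S_0}$ ways of choosing, for each $s\in S_0$, one of $s_0,s_1$ as $\varepsilon(s)$ and the other as $\tilde\varepsilon(s)$. Let $$I_G(a)=\sum_{k}\frac{(-1)^{\#S-k}\,\Gamma(\frac d2+k)}{U^{\frac d2+k}}\sum_{\{S_1,\dots,S_k\}}\ \prod_{j=1}^k U^{S_j},$$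 the inner sum being over the partitions of $S$ into $k$ nonempty parts, and $1\le k\le \#S$ (if $S=\emptyset$, only $k=0$ occurs and $I_G=\Gamma(\frac d2)/U^{d/2}$). **(1) Integrand of a vacuum diagram.** Let $b_1,\dots,b_L$ be a $\mathbb Z$-basis of the lattice of integral cycles of $G$, and let the edge momenta be $p_e=\sum_l b_l(e)k_l$ with loop momenta $k_l\in\mathbb R^d$ (Euclidean). For all $a_e>0$, $$\Gamma(\tfrac d2)\,\pi^{-Ld/2}\int_{(\mathbb R^d)^L}\ \prod_{s\in S}p_{s_0}\!\cdot p_{s_1}\;e^{-\sum_e a_e p_e^2}\,dk\;=\;I_G(a),$$ the integral being absolutely convergent. **(2) Residue of a vacuum diagram.** Assume that every edge of $G$ lies on a cycle. Let $e_0$ be an edge, $c$ an integral cycle with $c(e_0)=1$, $b_1,\dots,b_L$ a $\mathbb Z$-basis of the integral cycles vanishing on $e_0$, and $p_e=c(e)q+\sum_l b_l(e)k_l$, so that $p_{e_0}=q$. Let $\alpha_e>0$ be exponents with $\sum_e\alpha_e=(L+1)\frac d2+\#S$. Suppose that the integral below converges absolutely for some $q\ne0$. Then it does so for every $q\neq 0$,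 and $$\pi^{-Ld/2}\int_{(\mathbb R^d)^L}\ \prod_{s\in S}p_{s_0}\!\cdot p_{s_1}\prod_{e\ne e_0}\frac1{(p_e^2)^{\alpha_e}}\,dk\;=\;R\,(q^2)^{\alpha_{e_0}-\frac d2},$$ where the residue $R$ is given, for every nonempty set $T$ of edges, by the absolutely convergent integral $$R=\int_{a_e>0} I_G(a)\;\delta\Bigl(\sum_{e\in T}a_e-1\Bigr)\prod_{e\in E}\frac{a_e^{\alpha_e-1}\,da_e}{\Gamma(\alpha_e)} .$$ In particular $R$ depends neither on $e_0$ nor on $T$, as long as the convergence assumption holds. **(3) Propagator graphs.** Let $G$ have two exterior legs attached at vertices $u$ and $w$, let $\tilde G$ be the completed graph obtained by adding one edge $0$ joining $w$ to $u$, and assume that every edge of $\tilde G$ lies on a cycle. Let $c$ be an integral unit flow in $G$ from $u$ to $w$, $b_1,\dots,b_L$ a $\mathbb Z$-basis of the integral cycles of $G$, $p_e=c(e)q+\sum_l b_l(e)k_l$ for the edges of $G$ and $p_0=q$ the exterior momentum. Let $(s_0,s_1)_{s\in S}$ be pairs of edges of $\tilde G$, let $\alpha_e>0$ for the edges of $G$,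 and suppose that $\alpha_0$, defined by $\alpha_0+\sum_{e}\alpha_e=(L+1)\frac d2+\#S$, is positive. If the integral below converges absolutely for some $q\ne0$, then it does so for every $q\ne0$, and $$\pi^{-Ld/2}\int_{(\mathbb R^d)^L}\ \prod_{s\in S}p_{s_0}\!\cdot p_{s_1}\prod_{e\in E}\frac1{(p_e^2)^{\alpha_e}}\,dk\;=\;R\,(q^2)^{\alpha_0-\frac d2},$$ where $R$ is the absolutely convergent integral of (2) formed with $I_{\tilde G}$, the edges of $\tilde G$ and the exponents $\alpha_0,(\alpha_e)_e$, for every nonempty set $T$ of edges of $\tilde G$. -/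

import Mathlib

open MeasureTheory

noncomputable section

/-- A finite oriented multigraph with vertex type `V` and edge type `E`; multiple edges and
self-loops are allowed. The orientation is arbitrary and only fixes the sign of each momentum. -/
structure FeynmanGraph (V E : Type*) where
  src : E → V
  tgt : E → V

namespace FeynmanGraph

variable {V E S : Type*} [Fintype V] [DecidableEq V] [Fintype E] [DecidableEq E]
  [Fintype S] [DecidableEq S]

/-- Every two vertices are joined by a path of edges, followed in either direction. -/
def Connected (G : FeynmanGraph V E) : Prop :=
  ∀ x y : V, Relation.EqvGen (fun u v => ∃ e, G.src e = u ∧ G.tgt e = v) x y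

/-- The incidence matrix: `+1` at the target of an edge, `-1` at its source, and a zero row for a
self-loop. -/
def incidence (G : FeynmanGraph V E) : Matrix E V ℤ :=
  Matrix.of fun e v => (if G.tgt e = v then 1 else 0) - (if G.src e = v then 1 else 0)

/-- The lattice of integral cycles: integral edge flows that are conserved at every vertex. -/
def cycles (G : FeynmanGraph V E) : Submodule ℤ (E → ℤ) :=
  LinearMap.ker (Matrix.mulVecLin (Matrix.transpose G.incidence))

/-- The integral cycles that do not run through the edge `e₀`. -/
def cyclesAvoiding (G : FeynmanGraph V E) (e₀ : E) : Submodule ℤ (E → ℤ) :=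
  G.cycles ⊓ LinearMap.ker (LinearMap.proj e₀ : (E → ℤ) →ₗ[ℤ] ℤ)

/-- Every edge lies on a cycle, so that momentum conservation forces no edge momentum to vanish. -/
def Bridgeless (G : FeynmanGraph V E) : Prop :=
  ∀ e, ∃ c ∈ G.cycles, c e ≠ 0

/-- The completed graph of a graph whose two exterior legs are attached at `u` and `w`: a new edge
`none` leads from `w` back to `u`. -/
def completed (G : FeynmanGraph V E) (u w : V) : FeynmanGraph V (Option E) where
  src := fun o => o.elim w G.src
  tgt := fun o => o.elim u G.tgt

/-! ### Graph polynomials -/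

/-- The graph matrix, with the vertex `v₀` removed, at the Schwinger parameters `a`. -/
def graphMatrix (G : FeynmanGraph V E) (v₀ : V) (a : E → ℝ) :
    Matrix (E ⊕ {v : V // v ≠ v₀}) (E ⊕ {v : V // v ≠ v₀}) ℝ :=
  let B : Matrix E {v : V // v ≠ v₀} ℝ := Matrix.of fun e v => (G.incidence e v.1 : ℝ)
  Matrix.fromBlocks (Matrix.diagonal a) B (-(Matrix.transpose B)) 0

/-- The first Symanzik polynomial `U`. -/
def symanzik (G : FeynmanGraph V E) (v₀ : V) (a : E → ℝ) : ℝ :=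
  (G.graphMatrix v₀ a).det

/-- The Dodgson polynomial `U^{I,J}` for two families of edges `I`, `J` with the same index type:
the determinant of the graph matrix in which, for each `t`, the row of `I t` is replaced by the row
whose only nonzero entry is a `1` in the column of `J t`. It is `0` if `I` repeats an edge (if `J`
repeats an edge, the determinant has two equal rows and vanishes as well). -/
def dodgson (G : FeynmanGraph V E) (v₀ : V) (a : E → ℝ) {ι : Type*} [Fintype ι] [DecidableEq ι]
    (I J : ι → E) : ℝ :=
  if Function.Injective I then
    (Matrix.of fun r : E ⊕ {v : V // v ≠ v₀} =>
      if ∃ t, Sum.inl (I t) = r then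
        ∑ t with Sum.inl (I t) = r, Pi.single (Sum.inl (J t)) (1 : ℝ)
      else G.graphMatrix v₀ a r).det
  else 0

/-- One of the two entries of a pair of edges. -/
def pick (x : E × E) (i : Bool) : E := if i then x.1 else x.2

/-- The averaged Dodgson polynomial `U^{A}` of a set `A` of scalar products: the mean of
`U^{ε(A),ε̃(A)}` over the `2^{#A}` ways to choose, for every `t ∈ A`, which of the two edges of the
scalar product `t` is `ε t`, the other one being `ε̃ t`. -/
def avgDodgson (G : FeynmanGraph V E) (v₀ : V) (a : E → ℝ) (s : S → E × E) (A : Finset S) : ℝ :=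
  (1 / 2 ^ A.card) * ∑ σ : A → Bool,
    G.dodgson v₀ a (fun t : A => pick (s t) (σ t)) (fun t : A => pick (s t) (!(σ t)))

/-- The parametric integrand: the sum over `k` and over the partitions of `S` into `k` parts. (For
nonempty `S` there is no partition into `0` parts, so `k` runs from `1` to `#S`; for empty `S` the
only term is `Γ(d/2) / U^{d/2}`.) -/
def parametricIntegrand (G : FeynmanGraph V E) (v₀ : V) (d : ℕ) (s : S → E × E)
    (a : E → ℝ) : ℝ :=
  ∑ k ∈ Finset.range (Fintype.card S + 1),
    (-1) ^ (Fintype.card S - k) * Real.Gamma ((d : ℝ) / 2 + k)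
        / G.symanzik v₀ a ^ ((d : ℝ) / 2 + k) *
      ∑ P : Finpartition (Finset.univ : Finset S) with P.parts.card = k,
        ∏ A ∈ P.parts, G.avgDodgson v₀ a s A

/-! ### Projective integration over the Schwinger parameters -/

/-- Completes values on the edges other than `f` by the value at `f` for which the parameters of the
edges in `T` sum to `1` (if `f ∈ T`). -/
def fillSlice (T : Finset E) (f : E) (x : {e : E // e ≠ f} → ℝ) : E → ℝ := fun e =>
  if h : e = f then 1 - ∑ e' : {e : E // e ≠ f} with e'.1 ∈ T, x e' else x ⟨e, h⟩

/-- The part of the hyperplane `∑_{e ∈ T} a_e = 1` where all parameters are positive, in the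
coordinates `a_e`, `e ≠ f`. Lebesgue measure in these coordinates is the measure
`δ(∑_{e ∈ T} a_e - 1) ∏ da_e`. -/
def slice (T : Finset E) (f : E) : Set ({e : E // e ≠ f} → ℝ) :=
  {x | ∀ e, 0 < fillSlice T f x e}

/-- The integrand `I(a) ∏ a_e^{α_e - 1} / Γ(α_e)`. -/
def weightedIntegrand (G : FeynmanGraph V E) (v₀ : V) (d : ℕ) (s : S → E × E) (α : E → ℝ)
    (a : E → ℝ) : ℝ :=
  G.parametricIntegrand v₀ d s a * ∏ e, (a e ^ (α e - 1) / Real.Gamma (α e))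

/-- `∫ I(a) δ(∑_{e ∈ T} a_e - 1) ∏ a_e^{α_e - 1} da_e / Γ(α_e)`. -/
def parametricResidue (G : FeynmanGraph V E) (v₀ : V) (d : ℕ) (s : S → E × E) (α : E → ℝ)
    (T : Finset E) (f : E) : ℝ :=
  ∫ x in slice T f, G.weightedIntegrand v₀ d s α (fillSlice T f x)

/-! ### Momentum space -/

/-- The product over `t ∈ S` of the scalar products `p_{s₀} · p_{s₁}`. -/
def numerator {d : ℕ} (s : S → E × E) (p : E → EuclideanSpace ℝ (Fin d)) : ℝ :=
  ∏ t, inner ℝ (p (s t).1) (p (s t).2)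

/-- The edge momenta obtained when loop momenta `k l` run along the flows `b l` and an exterior
momentum `q` along the flow `c`. -/
def routedMomentum {d L : ℕ} (c : E → ℤ) (b : Fin L → E → ℤ) (q : EuclideanSpace ℝ (Fin d))
    (k : Fin L → EuclideanSpace ℝ (Fin d)) : E → EuclideanSpace ℝ (Fin d) :=
  fun e => c e • q + ∑ l, b l e • k l

/-- The momentum-space integrand of a vacuum diagram, every propagator `(p_e²)^{-α_e}` being
replaced by the factor `exp(-a_e p_e²)` of its Schwinger representation. -/
def schwingerFunction {d L : ℕ} (s : S → E × E) (b : Fin L → E → ℤ) (a : E → ℝ)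
    (k : Fin L → EuclideanSpace ℝ (Fin d)) : ℝ :=
  numerator s (routedMomentum 0 b 0 k) *
    Real.exp (-∑ e, a e * ‖routedMomentum 0 b 0 k e‖ ^ 2)

/-- The integrand of a vacuum diagram as a function of the Schwinger parameters: the normalized
integral over the loop momenta. -/
def vacuumIntegrand {L : ℕ} (d : ℕ) (s : S → E × E) (b : Fin L → E → ℤ) (a : E → ℝ) : ℝ :=
  Real.Gamma ((d : ℝ) / 2) * Real.pi ^ (-((L : ℝ) * d / 2)) *
    ∫ k : Fin L → EuclideanSpace ℝ (Fin d), schwingerFunction s b a k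

/-- The momentum-space integrand of a vacuum diagram cut at the edge `e₀`: the momentum of `e₀` is
the fixed exterior momentum, and `e₀` carries no propagator. -/
def cutFunction {d L : ℕ} (s : S → E × E) (α : E → ℝ) (e₀ : E) (c : E → ℤ) (b : Fin L → E → ℤ)
    (q : EuclideanSpace ℝ (Fin d)) (k : Fin L → EuclideanSpace ℝ (Fin d)) : ℝ :=
  numerator s (routedMomentum c b q k) *
    ∏ e ∈ Finset.univ.erase e₀, (‖routedMomentum c b q k e‖ ^ 2) ^ (-α e)

/-- The momentum-space integrand of a propagator graph with exterior momentum `q`. The numerator may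
contain the momenta of the edges (`some e`) and the exterior momentum (`none`). -/
def propagatorFunction {d L : ℕ} (s : S → Option E × Option E) (α : E → ℝ) (c : E → ℤ)
    (b : Fin L → E → ℤ) (q : EuclideanSpace ℝ (Fin d))
    (k : Fin L → EuclideanSpace ℝ (Fin d)) : ℝ :=
  numerator s (fun o => o.elim q (routedMomentum c b q k)) *
    ∏ e, (‖routedMomentum c b q k e‖ ^ 2) ^ (-α e)

/-- `R` is the residue of a diagram with `L` loops and momentum-space integrand `F q k` at exterior
momentum `q`: the integral over the loop momenta converges absolutely and equals
`R (q²)^{β₀ - d/2}` for all nonzero `q`. -/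
def IsResidue {d L : ℕ}
    (F : EuclideanSpace ℝ (Fin d) → (Fin L → EuclideanSpace ℝ (Fin d)) → ℝ) (β₀ R : ℝ) : Prop :=
  ∀ q, q ≠ 0 → Integrable (F q) ∧
    Real.pi ^ (-((L : ℝ) * d / 2)) * ∫ k, F q k = R * (‖q‖ ^ 2) ^ (β₀ - (d : ℝ) / 2)

end FeynmanGraph

end

/-! Part (1) is obtained by differentiating a Gaussian integral. Replace the diagonal block
`diag(a)` by any symmetric coercive matrix `X` indexed by edges. The integral of `exp(-∑ X e f
p_e·p_f)` over the loop momenta is `π^(Ld/2)` times the power `-d/2` of the Gram determinant of `X`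
on a basis of cycles. Since the cycle lattice is a direct summand of `ℤ^E`, this Gram determinant
equals the determinant of the block matrix with block `X` (`det_blockMatrix`). Differentiating in
the symmetric direction `pairMatrix (s r)` multiplies the integrand by `-p_{s₀}·p_{s₁}`. On the
other side, the derivative of a determinant in one entry replaces a row by a unit row, so mixed
derivatives of `U` are the averaged Dodgson polynomials. The derivatives of `Γ(d/2) U^(-d/2)` are
then sums over set partitions (`hasDerivAt_partitionSum`). An induction over the set of scalar
products (`integral_momentFunction`) proves (1) for all coercive `X` at once. The generality is
essential, as the perturbed matrices are no longer diagonal.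

For (2), the exterior momentum `q` is treated as one more loop momentum. By scaling and invariance
under isometries the cut integral is `C (q²)^(α_{e₀} - d/2)`, and the task is to identify `C`.
Integrating it over `q` against the edge factor of `e₀` would diverge, so the Schwinger parameter of
`e₀` is given the extra weight `a e^(-a)`; this turns the factor of `e₀` into `radialWeight`,
against which the power of `q²` has the integral `π^(d/2)/Γ(d/2)`. Exchanging the integrations over
momenta and Schwinger parameters and applying (1) inside gives the integral of `weightedIntegrand`
times `a_{e₀} e^(-a_{e₀})` over the orthant (`integral_weightedIntegrand`). The condition on `∑ α_e`
makes `weightedIntegrand` homogeneous of degree `-#E`, so the integral of the extra weight along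
each ray is 1 and what remains is the integral over any slice (`integral_slice_of_homogeneous`).
Hence neither `e₀` nor `T` matters.

Part (3) is (2) for the completed graph cut at its new edge. -/

namespace FeynmanGraph

/-! ### The cycle lattice and the determinant of the graph matrix -/

section GraphDeterminant

variable {V E : Type*} [Fintype V] [DecidableEq V] [Fintype E] [DecidableEq E]

/-- In a connected graph there is an integral flow between any two vertices. -/
lemma Connected.exists_flow {G : FeynmanGraph V E} (hG : G.Connected) (x y : V) :
    ∃ c : E → ℤ, ∀ v, ∑ e, G.incidence e v * c e =
      (if v = y then 1 else 0) - (if v = x then 1 else 0) := by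
  have h := hG x y
  induction h with
  | rel x y h =>
    obtain ⟨e, rfl, rfl⟩ := h
    refine ⟨Pi.single e 1, fun v => ?_⟩
    simp [incidence, Pi.single_apply, eq_comm]
  | refl x => exact ⟨0, fun v => by simp⟩
  | symm x y _ ih =>
    obtain ⟨c, hc⟩ := ih
    refine ⟨-c, fun v => ?_⟩
    simp [hc]
  | trans x y z _ _ ih1 ih2 =>
    obtain ⟨c, hc⟩ := ih1
    obtain ⟨c', hc'⟩ := ih2
    refine ⟨c + c', fun v => ?_⟩
    simp only [Pi.add_apply, mul_add, Finset.sum_add_distrib, hc, hc']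
    ring

lemma sum_incidence (G : FeynmanGraph V E) (e : E) : ∑ v, G.incidence e v = 0 := by
  simp [incidence]

lemma mem_cycles {G : FeynmanGraph V E} {c : E → ℤ} :
    c ∈ G.cycles ↔ ∀ v, ∑ e, G.incidence e v * c e = 0 := by
  simp only [cycles, LinearMap.mem_ker, Matrix.mulVecLin_apply, funext_iff, Matrix.mulVec,
    dotProduct, Matrix.transpose_apply, Pi.zero_apply]

/-- The incidence matrix with one vertex removed. -/
def redIncidence (G : FeynmanGraph V E) (v₀ : V) (R : Type*) [Ring R] :
    Matrix E {v : V // v ≠ v₀} R :=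
  Matrix.of fun e v => (G.incidence e v.1 : R)

/-- Conservation at all vertices but one implies conservation at the last one. -/
lemma mem_cycles_of_redIncidence {G : FeynmanGraph V E} {v₀ : V} {c : E → ℤ}
    (h : ∀ v, v ≠ v₀ → ∑ e, G.incidence e v * c e = 0) : c ∈ G.cycles := by
  refine mem_cycles.2 fun v => ?_
  by_cases hv : v = v₀
  · subst hv
    have h1 : ∑ w, ∑ e, G.incidence e w * c e = 0 := by
      rw [Finset.sum_comm]
      simp [← Finset.sum_mul, sum_incidence]
    rwa [← Finset.add_sum_erase _ _ (Finset.mem_univ v),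
      Finset.sum_eq_zero (s := Finset.univ.erase v), add_zero] at h1
    intro w hw
    exact h w (Finset.ne_of_mem_erase hw)
  · exact h v hv

/-- The matrix whose columns are given flows. -/
def flowMatrix {L : ℕ} (b : Fin L → E → ℤ) (R : Type*) [Ring R] : Matrix E (Fin L) R :=
  Matrix.of fun e l => (b l e : R)

lemma flowMatrix_mulVec_eq_zero {G : FeynmanGraph V E} {L : ℕ} (b : Module.Basis (Fin L) ℤ G.cycles)
    (x : Fin L → ℤ)
    (hx : Matrix.mulVec (flowMatrix (fun l => (b l : E → ℤ)) ℤ) x = 0) : x = 0 := by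
  have h1 : ∑ l, x l • b l = 0 := by
    apply Subtype.ext
    funext e
    have := congrFun hx e
    simp only [Matrix.mulVec, dotProduct, flowMatrix, Matrix.of_apply, Int.cast_id] at this
    simpa [Finset.sum_apply, mul_comm] using this
  funext l
  exact Fintype.linearIndependent_iff.1 b.linearIndependent x h1 l

/-- Basis cycles are linearly independent over `ℤ`, so their matrix can be cancelled on the left. -/
lemma flowMatrix_mul_left_injective {G : FeynmanGraph V E} {L : ℕ}
    (b : Module.Basis (Fin L) ℤ G.cycles) {m : Type*} {M N : Matrix (Fin L) m ℤ}
    (h : flowMatrix (fun l => (b l : E → ℤ)) ℤ * M =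
      flowMatrix (fun l => (b l : E → ℤ)) ℤ * N) : M = N := by
  ext l j
  have : Matrix.mulVec (flowMatrix (fun l => (b l : E → ℤ)) ℤ) (fun l => (M - N) l j) = 0 := by
    funext e
    have h3 : flowMatrix (fun l => (b l : E → ℤ)) ℤ * (M - N) = 0 := by
      rw [Matrix.mul_sub, h, sub_self]
    exact congrFun (congrFun h3 e) j
  have := congrFun (flowMatrix_mulVec_eq_zero b _ this) l
  simpa [sub_eq_zero] using this

/-- A basis of the lattice of cycles extends to a unimodular matrix by columns on which the
boundary map is the identity. -/
lemma exists_unimodular {G : FeynmanGraph V E} (hG : G.Connected) (v₀ : V) {L : ℕ}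
    (b : Module.Basis (Fin L) ℤ G.cycles) :
    ∃ (C : Matrix E {v : V // v ≠ v₀} ℤ) (D : Matrix (Fin L) E ℤ),
      (G.redIncidence v₀ ℤ).transpose * C = 1 ∧
      flowMatrix (fun l => (b l : E → ℤ)) ℤ * D + C * (G.redIncidence v₀ ℤ).transpose = 1 ∧
      D * flowMatrix (fun l => (b l : E → ℤ)) ℤ = 1 ∧ D * C = 0 ∧
      (G.redIncidence v₀ ℤ).transpose * flowMatrix (fun l => (b l : E → ℤ)) ℤ = 0 := by
  set β := flowMatrix (fun l => (b l : E → ℤ)) ℤ with hβ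
  set B := G.redIncidence v₀ ℤ with hB
  -- The column `v` of `C` is a unit flow from `v₀` to `v`; its boundary away from `v₀` is the unit
  -- vector at `v`.
  choose c hc using fun v => hG.exists_flow v₀ v
  let C : Matrix E {v : V // v ≠ v₀} ℤ := Matrix.of fun e v => c v.1 e
  have hBC : B.transpose * C = 1 := by
    ext v w
    have := hc w.1 v.1
    simp only [v.2, if_false, sub_zero] at this
    simp only [Matrix.mul_apply, Matrix.transpose_apply, hB, redIncidence, C, Matrix.of_apply,
      Int.cast_id, this, Matrix.one_apply, Subtype.ext_iff]
  have hBβ : B.transpose * β = 0 := by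
    ext v l
    have := mem_cycles.1 (b l).2 v.1
    simpa [Matrix.mul_apply, hB, hβ, redIncidence, flowMatrix] using this
  -- The unit vector at `e`, corrected by flows with the same boundary, is a cycle. Its coordinates
  -- in the basis `b` form the column `e` of `D`.
  have hcol : ∀ e : E, (fun e' => (1 - C * B.transpose : Matrix E E ℤ) e' e) ∈ G.cycles := by
    intro e
    apply mem_cycles_of_redIncidence (v₀ := v₀)
    intro v hv
    have h0 : B.transpose * (1 - C * B.transpose) = 0 := by
      rw [Matrix.mul_sub, ← Matrix.mul_assoc, hBC]; simp
    have := congrFun (congrFun h0 ⟨v, hv⟩) e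
    simpa [Matrix.mul_apply, hB, redIncidence] using this
  let D : Matrix (Fin L) E ℤ := Matrix.of fun l e => b.repr ⟨_, hcol e⟩ l
  have hβD : β * D = 1 - C * B.transpose := by
    ext e' e
    have h1 := b.sum_repr ⟨_, hcol e⟩
    have h2 := congrFun (congrArg Subtype.val h1) e'
    refine Eq.trans ?_ h2
    simp only [Matrix.mul_apply, hβ, flowMatrix, D, Matrix.of_apply, Int.cast_id,
      AddSubmonoidClass.coe_finsetSum, Submodule.coe_smul, Finset.sum_apply, Pi.smul_apply,
      smul_eq_mul]
    exact Finset.sum_congr rfl fun _ _ => mul_comm _ _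
  refine ⟨C, D, hBC, by rw [hβD]; simp, ?_, ?_, hBβ⟩
  · apply flowMatrix_mul_left_injective b
    rw [← Matrix.mul_assoc, ← hβ, hβD, Matrix.sub_mul, Matrix.mul_assoc, hBβ]; simp
  · apply flowMatrix_mul_left_injective b
    rw [← Matrix.mul_assoc, ← hβ, hβD, Matrix.sub_mul, Matrix.mul_assoc, hBC]; simp

/-- The graph matrix with an arbitrary block in place of the diagonal Schwinger parameters. -/
def blockMatrix (G : FeynmanGraph V E) (v₀ : V) (X : Matrix E E ℝ) :
    Matrix (E ⊕ {v : V // v ≠ v₀}) (E ⊕ {v : V // v ≠ v₀}) ℝ :=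
  Matrix.fromBlocks X (G.redIncidence v₀ ℝ) (-(G.redIncidence v₀ ℝ).transpose) 0

lemma graphMatrix_eq_blockMatrix (G : FeynmanGraph V E) (v₀ : V) (a : E → ℝ) :
    G.graphMatrix v₀ a = G.blockMatrix v₀ (Matrix.diagonal a) := rfl

/-- Congruence by an integral matrix with integral inverse preserves determinants. -/
lemma det_transpose_mul_mul_of_unimodular {m n : Type*} [Fintype m] [DecidableEq m] [Fintype n]
    [DecidableEq n] (P : Matrix m n ℤ) (Q : Matrix n m ℤ) (hPQ : P * Q = 1) (hQP : Q * P = 1)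
    (M : Matrix m m ℝ) :
    ((P.map (Int.cast : ℤ → ℝ)).transpose * M * P.map (Int.cast : ℤ → ℝ)).det = M.det := by
  set P' := P.map (Int.cast : ℤ → ℝ) with hP'
  set Q' := Q.map (Int.cast : ℤ → ℝ) with hQ'
  have hPQ' : P' * Q' = 1 := by
    have := congrArg (fun N => N.map (Int.castRingHom ℝ)) hPQ
    rw [Matrix.map_mul] at this
    simpa using this
  have hQP' : Q' * P' = 1 := by
    have := congrArg (fun N => N.map (Int.castRingHom ℝ)) hQP
    rw [Matrix.map_mul] at this
    simpa using this
  -- `P` may join different index types, so it has no determinant of its own. Splitting off `P'ᵀ P'`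
  -- leaves `Q' M P'`, which is conjugate to `M`. The other factor has a determinant that is a unit
  -- of `ℤ` and, as a Gram determinant, nonnegative.
  have h1 : P'.transpose * M * P' = (P'.transpose * P') * (Q' * M * P') := by
    calc _ = P'.transpose * (1 * M * P') := by simp [Matrix.mul_assoc]
      _ = _ := by rw [← hPQ']; simp only [Matrix.mul_assoc]
  have hdet : (P'.transpose * P').det = 1 := by
    have hu : IsUnit (P.transpose * P).det := by
      rw [← Matrix.isUnit_iff_isUnit_det]
      refine IsUnit.of_mul_eq_one (Q * Q.transpose) ?_
      calc P.transpose * P * (Q * Q.transpose) = P.transpose * (P * Q) * Q.transpose := by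
            simp only [Matrix.mul_assoc]
        _ = (Q * P).transpose := by rw [hPQ]; simp
        _ = 1 := by rw [hQP]; simp
    have hc : (P'.transpose * P').det = ((P.transpose * P).det : ℝ) := by
      have := (Int.castRingHom ℝ).map_det (P.transpose * P)
      simp only [Int.coe_castRingHom] at this
      rw [this]
      rw [RingHom.mapMatrix_apply, Matrix.map_mul]
      rfl
    have hn : 0 ≤ (P'.transpose * P').det := by
      have := (Matrix.posSemidef_conjTranspose_mul_self P').det_nonneg
      simpa using this
    rcases Int.isUnit_iff.1 hu with h | h
    · rw [hc, h]; simp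
    · rw [hc, h] at hn; norm_num at hn
  rw [h1, Matrix.det_mul, hdet, one_mul, Matrix.det_conj_of_mul_eq_one hQP' hPQ']

/-- The determinant of the graph matrix is the Gram determinant of a basis of cycles. -/
theorem det_blockMatrix {G : FeynmanGraph V E} (hG : G.Connected) (v₀ : V) {L : ℕ}
    (b : Module.Basis (Fin L) ℤ G.cycles) (X : Matrix E E ℝ) :
    (G.blockMatrix v₀ X).det =
      ((flowMatrix (fun l => (b l : E → ℤ)) ℝ).transpose * X *
        flowMatrix (fun l => (b l : E → ℤ)) ℝ).det := by
  obtain ⟨C, D, h1, h2, h3, h4, h5⟩ := exists_unimodular hG v₀ b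
  set β := flowMatrix (fun l => (b l : E → ℤ)) ℤ with hβ
  set B := G.redIncidence v₀ ℤ with hB
  -- New coordinates on the edge space: cycles `β` and the complement spanned by `C`. In them the
  -- incidence block becomes zero on cycles and the identity on the complement.
  let P : Matrix (E ⊕ {v : V // v ≠ v₀}) ((Fin L ⊕ {v : V // v ≠ v₀}) ⊕ {v : V // v ≠ v₀}) ℤ :=
    Matrix.fromBlocks (Matrix.fromCols β C) 0 0 1
  let Q : Matrix ((Fin L ⊕ {v : V // v ≠ v₀}) ⊕ {v : V // v ≠ v₀}) (E ⊕ {v : V // v ≠ v₀}) ℤ :=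
    Matrix.fromBlocks (Matrix.fromRows D B.transpose) 0 0 1
  have hPQ : P * Q = 1 := by
    simp only [P, Q, Matrix.fromBlocks_multiply, Matrix.fromCols_mul_fromRows, h2]
    simp
  have hQP : Q * P = 1 := by
    simp only [P, Q, Matrix.fromBlocks_multiply, Matrix.fromRows_mul_fromCols, h1, h3, h4, h5]
    simp
  rw [← det_transpose_mul_mul_of_unimodular P Q hPQ hQP]
  set β' := flowMatrix (fun l => (b l : E → ℤ)) ℝ with hβ'
  set C' := C.map (Int.cast : ℤ → ℝ) with hC'
  set B' := G.redIncidence v₀ ℝ with hB'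
  have hββ : β.map (Int.cast : ℤ → ℝ) = β' := by ext; simp [hβ, hβ', flowMatrix]
  have hBB : B.map (Int.cast : ℤ → ℝ) = B' := by ext; simp [hB, hB', redIncidence]
  have h1' : B'.transpose * C' = 1 := by
    have := congrArg (fun N => N.map (Int.castRingHom ℝ)) h1
    rw [Matrix.map_mul] at this
    simpa [← hBB, Matrix.transpose_map] using this
  have h5' : B'.transpose * β' = 0 := by
    have := congrArg (fun N => N.map (Int.castRingHom ℝ)) h5
    rw [Matrix.map_mul] at this
    simpa [← hBB, ← hββ, Matrix.transpose_map] using this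
  have h1'' : C'.transpose * B' = 1 := by
    have := congrArg Matrix.transpose h1'; simpa [Matrix.transpose_mul] using this
  have h5'' : β'.transpose * B' = 0 := by
    have := congrArg Matrix.transpose h5'; simpa [Matrix.transpose_mul] using this
  have hP : P.map (Int.cast : ℤ → ℝ) = Matrix.fromBlocks (Matrix.fromCols β' C') 0 0 1 := by
    rw [← hββ]
    ext (i | i) ((j | j) | j) <;> simp [P, hC', Matrix.one_apply]
  let W : Matrix ({v : V // v ≠ v₀} ⊕ {v : V // v ≠ v₀}) ({v : V // v ≠ v₀} ⊕ {v : V // v ≠ v₀}) ℝ :=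
    Matrix.fromBlocks (C'.transpose * X * C') 1 (-1) 0
  have key : ((P.map (Int.cast : ℤ → ℝ)).transpose * G.blockMatrix v₀ X *
      P.map (Int.cast : ℤ → ℝ)) = Matrix.fromBlocks
        (Matrix.fromBlocks (β'.transpose * X * β') (β'.transpose * X * C')
          (C'.transpose * X * β') (C'.transpose * X * C'))
        (Matrix.fromRows 0 1) (Matrix.fromCols 0 (-1)) 0 := by
    rw [hP, blockMatrix, ← hB', Matrix.fromBlocks_transpose, Matrix.fromBlocks_multiply,
      Matrix.fromBlocks_multiply]
    simp only [Matrix.transpose_zero, Matrix.transpose_one, Matrix.zero_mul, Matrix.mul_zero,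
      add_zero, Matrix.one_mul, Matrix.mul_one, zero_add, Matrix.transpose_fromCols,
      Matrix.fromRows_mul, Matrix.neg_mul, Matrix.mul_fromCols, h1', h5', h1'', h5'',
      Matrix.fromRows_mul_fromCols, neg_zero]
    congr 1
    · ext (i | i) (j | j) <;> simp
    · ext i (j | j) <;> simp
  have key' : ((P.map (Int.cast : ℤ → ℝ)).transpose * G.blockMatrix v₀ X *
      P.map (Int.cast : ℤ → ℝ)).submatrix (Equiv.sumAssoc _ _ _).symm (Equiv.sumAssoc _ _ _).symm =
      Matrix.fromBlocks (β'.transpose * X * β') (Matrix.fromCols (β'.transpose * X * C') 0)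
        (Matrix.fromRows (C'.transpose * X * β') 0) W := by
    rw [key]
    ext (i | i | i) (j | j | j) <;> simp [W]
  have hWdet : W.det = 1 := by
    have h : W * Matrix.fromBlocks 1 0 (1 - C'.transpose * X * C') 1 =
        Matrix.fromBlocks 1 1 (-1) 0 := by
      simp [W, Matrix.fromBlocks_multiply]
    have h' := congrArg Matrix.det h
    rwa [Matrix.det_mul, Matrix.det_fromBlocks_zero₁₂, Matrix.det_fromBlocks_one₁₁, Matrix.det_one,
      Matrix.mul_one, zero_sub, neg_neg, Matrix.det_one, mul_one, mul_one] at h'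
  -- The identity block inside `W` clears the lower left corner by a column operation that leaves
  -- the Gram block untouched.
  let K : Matrix ({v : V // v ≠ v₀} ⊕ {v : V // v ≠ v₀}) (Fin L) ℝ :=
    Matrix.fromRows 0 (-(C'.transpose * X * β'))
  have hW : W * K = -Matrix.fromRows (C'.transpose * X * β') 0 := by
    simp only [W, K, Matrix.fromBlocks_mul_fromRows]
    ext (i | i) j <;> simp
  have hmul : Matrix.fromBlocks (β'.transpose * X * β') (Matrix.fromCols (β'.transpose * X * C') 0)
        (Matrix.fromRows (C'.transpose * X * β') 0) W *
      Matrix.fromBlocks 1 0 K 1 =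
      Matrix.fromBlocks (β'.transpose * X * β')
        (Matrix.fromCols (β'.transpose * X * C') 0) 0 W := by
    rw [Matrix.fromBlocks_multiply, hW, Matrix.fromCols_mul_fromRows]
    simp only [mul_one, mul_zero, Matrix.mul_one, Matrix.mul_zero, Matrix.zero_mul, add_zero,
      zero_add, add_neg_cancel]
  have hdet := congrArg Matrix.det hmul
  rw [Matrix.det_mul, Matrix.det_fromBlocks_zero₁₂, Matrix.det_fromBlocks_zero₂₁, Matrix.det_one,
    Matrix.det_one, mul_one, mul_one, hWdet, mul_one] at hdet
  rw [← Matrix.det_submatrix_equiv_self (Equiv.sumAssoc _ _ _).symm, key', hdet]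

end GraphDeterminant

end FeynmanGraph

namespace FeynmanGraph

/-! ### Row replacement as differentiation of determinants -/

section DodgsonDerivative

variable {n S : Type*} [Fintype n] [DecidableEq n] [DecidableEq S]

/-- The determinant of a matrix in which, for each `t ∈ A`, the row `I t` is replaced by the unit
row at `J t`; it is `0` if `I` is not injective on `A`. -/
noncomputable def rowDet (M : Matrix n n ℝ) (I J : S → n) (A : Finset S) : ℝ :=
  open Classical in
  if Set.InjOn I A then
    (Matrix.of fun r => if ∃ t ∈ A, I t = r then
      ∑ t ∈ A with I t = r, Pi.single (J t) (1 : ℝ) else M r).det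
  else 0

lemma rowDet_empty (M : Matrix n n ℝ) (I J : S → n) : rowDet M I J ∅ = M.det := by
  simp [rowDet]
  rfl

lemma rowDet_congr (M : Matrix n n ℝ) {I J I' J' : S → n} {A : Finset S}
    (hI : ∀ t ∈ A, I t = I' t) (hJ : ∀ t ∈ A, J t = J' t) : rowDet M I J A = rowDet M I' J' A := by
  classical
  have h1 : Set.InjOn I A ↔ Set.InjOn I' A := Set.EqOn.injOn_iff (fun t ht => hI t ht)
  unfold rowDet
  simp only [h1]
  congr 2
  ext r c
  have h2 : (∃ t ∈ A, I t = r) ↔ ∃ t ∈ A, I' t = r :=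
    exists_congr fun t => and_congr_right fun ht => by rw [hI t ht]
  have h3 : A.filter (fun t => I t = r) = A.filter (fun t => I' t = r) :=
    Finset.filter_congr fun t ht => by rw [hI t ht]
  simp only [Matrix.of_apply, h2, h3]
  have h4 : ∑ t ∈ A with I' t = r, (Pi.single (J t) (1 : ℝ) : n → ℝ) =
      ∑ t ∈ A with I' t = r, Pi.single (J' t) (1 : ℝ) :=
    Finset.sum_congr rfl fun t ht => by rw [hJ t (Finset.mem_filter.1 ht).1]
  rw [h4]

/-- The determinant with replaced rows depends affinely on each entry of the matrix, with the
derivative obtained by one more replacement. -/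
lemma rowDet_add_single (M : Matrix n n ℝ) (I J : S → n) {A : Finset S} {s : S} (hs : s ∉ A)
    (x : ℝ) :
    rowDet (M + x • Matrix.single (I s) (J s) 1) I J A =
      rowDet M I J A + x * rowDet M I J (insert s A) := by
  classical
  by_cases hA : Set.InjOn I A
  swap
  · have : ¬ Set.InjOn I (insert s A : Finset S) := fun h => hA (h.mono (by simp))
    rw [rowDet, rowDet, rowDet, if_neg hA, if_neg hA, if_neg this]; simp
  -- If the row is already replaced, the perturbed entry is no longer present. The derivative is
  -- zero, which is the value assigned to a repeated row.
  by_cases hex : ∃ t ∈ A, I t = I s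
  · have : ¬ Set.InjOn I (insert s A : Finset S) := by
      obtain ⟨t, ht, hts⟩ := hex
      intro h
      exact hs (h (by simp [ht]) (by simp) hts ▸ ht)
    simp only [rowDet, hA, this, if_true, if_false, mul_zero, add_zero]
    congr 1
    ext r c
    by_cases hr : ∃ t ∈ A, I t = r
    · simp [hr]
    · have hrs : I s ≠ r := fun h => hr (h ▸ hex)
      simp [hr, Matrix.single_apply, hrs]
  · have hA' : Set.InjOn I (insert s A : Finset S) := by
      rw [Finset.coe_insert, Set.injOn_insert (by simpa using hs)]
      exact ⟨hA, by simpa using hex⟩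
    simp only [rowDet, hA, hA', if_true]
    set N : Matrix n n ℝ := Matrix.of fun r => if ∃ t ∈ A, I t = r then
      ∑ t ∈ A with I t = r, Pi.single (J t) (1 : ℝ) else M r with hN
    have e1 : (Matrix.of fun r => if ∃ t ∈ A, I t = r then
        ∑ t ∈ A with I t = r, Pi.single (J t) (1 : ℝ)
        else (M + x • Matrix.single (I s) (J s) 1 : Matrix n n ℝ) r) =
        N.updateRow (I s) (N (I s) + x • Pi.single (J s) 1) := by
      ext r c
      by_cases hr : r = I s
      · subst hr
        have hNs : N (I s) = M (I s) := if_neg hex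
        rw [Matrix.of_apply, if_neg hex, Matrix.updateRow_self, hNs]
        simp [Matrix.single_apply, Pi.single_apply, eq_comm]
      · simp [hN, Matrix.updateRow_ne hr, Matrix.single_apply, Ne.symm hr]
        split_ifs <;> simp [Matrix.single_apply, Ne.symm hr]
    have e2 : (Matrix.of fun r => if ∃ t ∈ insert s A, I t = r then
        ∑ t ∈ insert s A with I t = r, Pi.single (J t) (1 : ℝ) else M r) =
        N.updateRow (I s) (Pi.single (J s) 1) := by
      ext r c
      by_cases hr : r = I s
      · subst hr
        have : A.filter (fun t => I t = I s) = ∅ :=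
          Finset.filter_eq_empty_iff.2 fun t ht h => hex ⟨t, ht, h⟩
        simp [Finset.filter_insert, this]
      · simp [hN, Matrix.updateRow_ne hr, Ne.symm hr, Finset.filter_insert]
    rw [e1, e2, Matrix.det_updateRow_add, Matrix.det_updateRow_smul, Matrix.updateRow_eq_self]

lemma continuous_rowDet (I J : S → n) (A : Finset S) :
    Continuous fun M : Matrix n n ℝ => rowDet M I J A := by
  classical
  unfold rowDet
  by_cases hA : Set.InjOn I A
  · simp only [hA, if_true]
    refine Continuous.matrix_det (continuous_matrix fun r c => ?_)
    by_cases hr : ∃ t ∈ A, I t = r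
    · simp only [Matrix.of_apply, hr, if_true]; exact continuous_const
    · simp only [Matrix.of_apply, hr, if_false]; exact continuous_id.matrix_elem r c
  · simp only [hA, if_false]; exact continuous_const

/-- The derivative in the direction of two entries of the matrix. -/
lemma hasDerivAt_rowDet (M : Matrix n n ℝ) (I J : S → n) {A : Finset S} {s : S} (hs : s ∉ A)
    (i₁ j₁ i₂ j₂ : n) :
    HasDerivAt (fun t : ℝ => rowDet (M + t • ((1 / 2 : ℝ) • Matrix.single i₁ j₁ 1 +
        (1 / 2 : ℝ) • Matrix.single i₂ j₂ 1)) I J A)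
      (1 / 2 * rowDet M (Function.update I s i₁) (Function.update J s j₁) (insert s A) +
        1 / 2 * rowDet M (Function.update I s i₂) (Function.update J s j₂) (insert s A)) 0 := by
  have hne : ∀ t ∈ A, t ≠ s := fun t ht h => hs (h ▸ ht)
  have key : ∀ (N : Matrix n n ℝ) (i j : n) (x : ℝ), rowDet (N + x • Matrix.single i j 1) I J A =
      rowDet N I J A +
        x * rowDet N (Function.update I s i) (Function.update J s j) (insert s A) := by
    intro N i j x
    have h := rowDet_add_single N (Function.update I s i) (Function.update J s j) hs x
    rw [Function.update_self, Function.update_self] at h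
    have hc : ∀ N : Matrix n n ℝ, rowDet N I J A =
        rowDet N (Function.update I s i) (Function.update J s j) A := fun N =>
      rowDet_congr N (fun t ht => by rw [Function.update_of_ne (hne t ht)])
        (fun t ht => by rw [Function.update_of_ne (hne t ht)])
    rw [hc, hc N]
    exact h
  set R := fun N : Matrix n n ℝ =>
    rowDet N (Function.update I s i₁) (Function.update J s j₁) (insert s A) with hR
  have e : (fun t : ℝ => rowDet (M + t • ((1 / 2 : ℝ) • Matrix.single i₁ j₁ 1 +
      (1 / 2 : ℝ) • Matrix.single i₂ j₂ 1)) I J A) = fun t => rowDet M I J A +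
      t * (1 / 2 * rowDet M (Function.update I s i₂) (Function.update J s j₂) (insert s A) +
        1 / 2 * R (M + (t * (1 / 2)) • Matrix.single i₂ j₂ 1)) := by
    funext t
    have : M + t • ((1 / 2 : ℝ) • Matrix.single i₁ j₁ (1 : ℝ) +
        (1 / 2 : ℝ) • Matrix.single i₂ j₂ (1 : ℝ)) =
        (M + (t * (1 / 2)) • Matrix.single i₂ j₂ 1) + (t * (1 / 2)) • Matrix.single i₁ j₁ 1 := by
      rw [smul_add, smul_smul, smul_smul]; abel
    rw [this, key, key, hR]
    ring
  rw [e]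
  -- The bracket is the difference quotient at `t ≠ 0`, so its continuity at 0 is enough. The second
  -- order term from perturbing both entries is contained in `R`.
  have hcont : ContinuousAt (fun t : ℝ =>
      1 / 2 * rowDet M (Function.update I s i₂) (Function.update J s j₂) (insert s A) +
        1 / 2 * R (M + (t * (1 / 2)) • Matrix.single i₂ j₂ 1)) 0 := by
    apply Continuous.continuousAt
    have hRc : Continuous R := continuous_rowDet _ _ _
    exact continuous_const.add (continuous_const.mul (hRc.comp (by fun_prop)))
  rw [hasDerivAt_iff_tendsto_slope_zero]
  have h2 := hcont.tendsto.mono_left (nhdsWithin_le_nhds (s := {0}ᶜ))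
  simp only [zero_mul, zero_smul, add_zero] at h2
  rw [add_comm] at h2
  refine h2.congr' ?_
  filter_upwards [self_mem_nhdsWithin] with t ht
  have ht' : t ≠ 0 := ht
  simp only [zero_add, zero_mul, add_zero, smul_eq_mul]
  field_simp
  ring

end DodgsonDerivative

/-! ### Averaged Dodgson polynomials as mixed derivatives -/

section Average

variable {V E S : Type*} [Fintype V] [DecidableEq V] [Fintype E] [DecidableEq E]
  [Fintype S] [DecidableEq S]

/-- The averaged Dodgson polynomial with an arbitrary edge block. -/
noncomputable def avgRowDet (G : FeynmanGraph V E) (v₀ : V) (s : S → E × E) (X : Matrix E E ℝ)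
    (A : Finset S) : ℝ :=
  (1 / 2 ^ Fintype.card S) * ∑ σ : S → Bool, rowDet (G.blockMatrix v₀ X)
    (fun t => Sum.inl (pick (s t) (σ t))) (fun t => Sum.inl (pick (s t) (!(σ t)))) A

lemma avgRowDet_empty (G : FeynmanGraph V E) (v₀ : V) (s : S → E × E) (X : Matrix E E ℝ) :
    G.avgRowDet v₀ s X ∅ = (G.blockMatrix v₀ X).det := by
  simp [avgRowDet, rowDet_empty]

/-- The symmetric matrix whose quadratic form is the product of the entries of `x`. -/
noncomputable def pairMatrix (x : E × E) : Matrix E E ℝ :=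
  (1 / 2 : ℝ) • Matrix.single x.1 x.2 1 + (1 / 2 : ℝ) • Matrix.single x.2 x.1 1

lemma blockMatrix_add (G : FeynmanGraph V E) (v₀ : V) (X : Matrix E E ℝ) (x : E × E) (t : ℝ) :
    G.blockMatrix v₀ (X + t • pairMatrix x) = G.blockMatrix v₀ X +
      t • ((1 / 2 : ℝ) • Matrix.single (Sum.inl x.1) (Sum.inl x.2) 1 +
        (1 / 2 : ℝ) • Matrix.single (Sum.inl x.2) (Sum.inl x.1) 1) := by
  ext (i | i) (j | j) <;> simp [blockMatrix, pairMatrix, Matrix.single_apply]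

/-- The two entries of `pairMatrix (s r)` correspond to the two choices at `r`. Averaging over
choices on all of `S`, and not only on `A`, gives both sides the same index set. -/
theorem hasDerivAt_avgRowDet (G : FeynmanGraph V E) (v₀ : V) (s : S → E × E) (X : Matrix E E ℝ)
    {A : Finset S} {r : S} (hr : r ∉ A) :
    HasDerivAt (fun t : ℝ => G.avgRowDet v₀ s (X + t • pairMatrix (s r)) A)
      (G.avgRowDet v₀ s X (insert r A)) 0 := by
  have hne : ∀ t ∈ A, t ≠ r := fun t ht h => hr (h ▸ ht)
  let g : (S → Bool) → ℝ := fun σ => rowDet (G.blockMatrix v₀ X)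
    (fun t => Sum.inl (pick (s t) (σ t))) (fun t => Sum.inl (pick (s t) (!(σ t)))) (insert r A)
  have hder : ∀ σ : S → Bool, HasDerivAt (fun t : ℝ => rowDet
      (G.blockMatrix v₀ (X + t • pairMatrix (s r)))
      (fun t => Sum.inl (pick (s t) (σ t))) (fun t => Sum.inl (pick (s t) (!(σ t)))) A)
      (1 / 2 * g σ + 1 / 2 * g (Function.update σ r (!(σ r)))) 0 := by
    intro σ
    simp only [blockMatrix_add]
    have hu : ∀ b : Bool, rowDet (G.blockMatrix v₀ X)
        (Function.update (fun t => Sum.inl (pick (s t) (σ t))) r (Sum.inl (pick (s r) b)))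
        (Function.update (fun t => Sum.inl (pick (s t) (!(σ t)))) r (Sum.inl (pick (s r) (!b))))
        (insert r A) = g (Function.update σ r b) := by
      intro b
      refine rowDet_congr _ (fun t _ => ?_) (fun t _ => ?_) <;>
      · by_cases h : t = r
        · subst h; simp
        · simp [h]
    have h := hasDerivAt_rowDet (G.blockMatrix v₀ X) (fun t => Sum.inl (pick (s t) (σ t)))
      (fun t => Sum.inl (pick (s t) (!(σ t)))) hr (Sum.inl (s r).1) (Sum.inl (s r).2)
      (Sum.inl (s r).2) (Sum.inl (s r).1)
    have h1 := hu true
    have h2 := hu false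
    have hp : ∀ x : E × E, pick x true = x.1 ∧ pick x false = x.2 := fun x => ⟨rfl, rfl⟩
    rw [Bool.not_true, (hp _).1, (hp _).2] at h1
    rw [Bool.not_false, (hp _).1, (hp _).2] at h2
    rw [h1, h2] at h
    convert h using 1
    cases hσ : σ r
    · have : Function.update σ r false = σ := by rw [← hσ, Function.update_eq_self]
      rw [this]; simp [add_comm]
    · have : Function.update σ r true = σ := by rw [← hσ, Function.update_eq_self]
      rw [this]; simp
  have hsum := (HasDerivAt.fun_sum (u := Finset.univ) fun σ _ => hder σ).const_mul
    (1 / 2 ^ Fintype.card S : ℝ)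
  -- Flipping the choice at `r` permutes all choices, so the two halves have the same sum.
  have hflip : ∑ σ : S → Bool, g (Function.update σ r (!(σ r))) = ∑ σ, g σ := by
    refine Finset.sum_nbij' (fun σ => Function.update σ r (!(σ r)))
      (fun σ => Function.update σ r (!(σ r))) ?_ ?_ ?_ ?_ ?_ <;> simp
  refine hsum.congr_deriv ?_
  rw [Finset.sum_add_distrib, ← Finset.mul_sum, ← Finset.mul_sum, hflip, avgRowDet]
  ring

lemma rowDet_subtype (G : FeynmanGraph V E) (v₀ : V) (a : E → ℝ) (I J : S → E) (A : Finset S) :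
    rowDet (G.graphMatrix v₀ a) (fun t => Sum.inl (I t)) (fun t => Sum.inl (J t)) A =
      G.dodgson v₀ a (fun t : A => I t) (fun t : A => J t) := by
  classical
  unfold rowDet dodgson
  have h1 : Set.InjOn (fun t => (Sum.inl (I t) : E ⊕ {v : V // v ≠ v₀})) A ↔
      Function.Injective (fun t : A => I t) := by
    rw [Set.injOn_iff_injective]
    constructor
    · intro h x y hxy
      exact h (congrArg Sum.inl hxy)
    · intro h x y hxy
      exact h (Sum.inl_injective hxy)
  simp only [h1]
  congr 2
  ext r c
  have h2 : (∃ t ∈ A, (Sum.inl (I t) : E ⊕ {v : V // v ≠ v₀}) = r) ↔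
      ∃ t : A, Sum.inl (I t) = r := by simp
  have h3 := (Finset.sum_coe_sort A fun t => if (Sum.inl (I t) : E ⊕ {v : V // v ≠ v₀}) = r then
    (Pi.single (Sum.inl (J t)) (1 : ℝ) : E ⊕ {v : V // v ≠ v₀} → ℝ) else 0).symm
  simp only [Matrix.of_apply, h2, Finset.sum_filter, h3]

/-- Choices outside `A` do not affect the determinant, so each choice on `A` is counted `2^(#S -
#A)` times, which the normalization compensates. -/
theorem avgDodgson_eq_avgRowDet (G : FeynmanGraph V E) (v₀ : V) (a : E → ℝ) (s : S → E × E)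
    (A : Finset S) :
    G.avgDodgson v₀ a s A = G.avgRowDet v₀ s (Matrix.diagonal a) A := by
  unfold avgDodgson avgRowDet
  rw [← graphMatrix_eq_blockMatrix]
  simp only [rowDet_subtype G v₀ a (fun t => pick (s t) _)]
  let g : (A → Bool) → ℝ := fun σ =>
    G.dodgson v₀ a (fun t : A => pick (s t) (σ t)) (fun t : A => pick (s t) (!(σ t)))
  have h : ∑ σ : S → Bool, g (fun t => σ t) = 2 ^ (Fintype.card S - A.card) * ∑ σ, g σ := by
    rw [← (Equiv.piEquivPiSubtypeProd (fun t => t ∈ A) (fun _ => Bool)).symm.sum_comp,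
      Fintype.sum_prod_type]
    simp only [Equiv.piEquivPiSubtypeProd_symm_apply]
    simp only [Finset.sum_const, Finset.mul_sum]
    refine Finset.sum_congr rfl fun σ _ => ?_
    simp [Fintype.card_subtype_compl]
  change _ * ∑ σ, g σ = _ * ∑ σ : S → Bool, g (fun t => σ t)
  rw [h, ← mul_assoc]
  congr 1
  have hc : A.card ≤ Fintype.card S := Finset.card_le_univ A
  rw [pow_sub₀ _ two_ne_zero hc]
  field_simp

end Average

end FeynmanGraph

/-! ### Set partitions of a set with one more element -/

section Finpartition

variable {S : Type*} [DecidableEq S]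

lemma Finpartition.existsUnique_mem_parts {A : Finset S} (P : Finpartition A) {a : S} (ha : a ∈ A) :
    ∃ t ∈ P.parts, a ∈ t ∧ ∀ u ∈ P.parts, a ∈ u → u = t := by
  obtain ⟨t, ht, hat⟩ := P.exists_mem ha
  exact ⟨t, ht, hat, fun u hu hau => P.eq_of_mem_parts hu ht hau hat⟩

/-- Inserts a new element into a part of a partition, or adds it as a new singleton if the given
set is empty. -/
def Finpartition.insertInto {A : Finset S} (P : Finpartition A) (s : S) (hs : s ∉ A) (B : Finset S)
    (hB : B ∈ insert ∅ P.parts) : Finpartition (insert s A) :=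
  Finpartition.ofExistsUnique (insert (insert s B) (P.parts.erase B))
    (by
      have hBA : B ⊆ A := by
        rcases Finset.mem_insert.1 hB with rfl | h
        · exact Finset.empty_subset _
        · exact P.subset h
      intro p hp
      rcases Finset.mem_insert.1 hp with rfl | h
      · exact Finset.insert_subset_insert _ hBA
      · exact (P.subset (Finset.mem_of_mem_erase h)).trans (Finset.subset_insert _ _))
    (by
      intro a ha
      by_cases has : a = s
      · subst has
        refine ⟨insert a B, ⟨by simp, by simp⟩, ?_⟩
        rintro t ⟨ht, hat⟩
        rcases Finset.mem_insert.1 ht with rfl | h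
        · rfl
        · exact absurd (P.subset (Finset.mem_of_mem_erase h) hat) hs
      · have haA : a ∈ A := (Finset.mem_insert.1 ha).resolve_left has
        obtain ⟨t, ht, hat, hu⟩ := P.existsUnique_mem_parts haA
        by_cases htB : t = B
        · subst htB
          refine ⟨insert s t, ⟨by simp, by simp [hat]⟩, ?_⟩
          rintro u ⟨h, hau⟩
          rcases Finset.mem_insert.1 h with rfl | h
          · rfl
          · exact absurd (hu u (Finset.mem_of_mem_erase h) hau) (Finset.ne_of_mem_erase h)
        · refine ⟨t, ⟨by simp [ht, htB], hat⟩, ?_⟩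
          rintro u ⟨h, hau⟩
          rcases Finset.mem_insert.1 h with rfl | h
          · have haB : a ∈ B := (Finset.mem_insert.1 hau).resolve_left has
            rcases Finset.mem_insert.1 hB with rfl | hB
            · simp at haB
            · exact absurd (hu B hB haB).symm htB
          · exact hu u (Finset.mem_of_mem_erase h) hau)
    (by
      intro h
      rcases Finset.mem_insert.1 h with h | h
      · exact (Finset.insert_ne_empty _ _) h.symm
      · exact P.empty_notMem_parts (Finset.mem_of_mem_erase h))

lemma Finpartition.parts_insertInto {A : Finset S} (P : Finpartition A) (s : S) (hs : s ∉ A)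
    (B : Finset S) (hB : B ∈ insert ∅ P.parts) :
    (P.insertInto s hs B hB).parts = insert (insert s B) (P.parts.erase B) := rfl

/-- Remove `s` from its part `C` and take `B = C.erase s`. If `C = {s}`, then `B` is empty and has
to be dropped from the parts, hence the `erase ∅` in the construction of `P`. -/
lemma Finpartition.exists_insertInto {A : Finset S} {s : S} (hs : s ∉ A)
    (Q : Finpartition (insert s A)) :
    ∃ (P : Finpartition A) (B : Finset S) (hB : B ∈ insert ∅ P.parts),
      P.insertInto s hs B hB = Q := by
  obtain ⟨C, hC, hsC, hCu⟩ := Q.existsUnique_mem_parts (Finset.mem_insert_self s A)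
  have hdisj : ∀ u ∈ Q.parts, ∀ a ∈ u, a ∈ C → u = C := fun u hu a hau haC =>
    Q.eq_of_mem_parts hu hC hau haC
  have hBA : C.erase s ⊆ A := fun a ha =>
    (Finset.mem_insert.1 (Q.subset hC (Finset.mem_of_mem_erase ha))).resolve_left
      (Finset.ne_of_mem_erase ha)
  have hBn : C.erase s ∉ Q.parts.erase C := by
    intro h
    obtain ⟨a, ha⟩ := Q.nonempty_of_mem_parts (Finset.mem_of_mem_erase h)
    exact (Finset.ne_of_mem_erase h)
      (hdisj _ (Finset.mem_of_mem_erase h) a ha (Finset.mem_of_mem_erase ha))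
  have hempty : ∅ ∉ Q.parts.erase C := fun h =>
    Q.empty_notMem_parts (Finset.mem_of_mem_erase h)
  let P : Finpartition A := Finpartition.ofExistsUnique
    ((insert (C.erase s) (Q.parts.erase C)).erase ∅)
    (by
      intro p hp
      rcases Finset.mem_insert.1 (Finset.mem_of_mem_erase hp) with rfl | h
      · exact hBA
      · intro a ha
        have hp' := Finset.mem_of_mem_erase h
        refine (Finset.mem_insert.1 (Q.subset hp' ha)).resolve_left ?_
        rintro rfl
        exact Finset.ne_of_mem_erase h (hCu p hp' ha))
    (by
      intro a ha
      have has : a ≠ s := fun h => hs (h ▸ ha)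
      obtain ⟨t, ht, hat, hu⟩ := Q.existsUnique_mem_parts (Finset.mem_insert_of_mem ha)
      by_cases htC : t = C
      · subst htC
        have haB : a ∈ t.erase s := Finset.mem_erase.2 ⟨has, hat⟩
        refine ⟨t.erase s, ⟨?_, haB⟩, ?_⟩
        · exact Finset.mem_erase.2 ⟨Finset.ne_empty_of_mem haB, Finset.mem_insert_self _ _⟩
        · rintro u ⟨h, hau⟩
          rcases Finset.mem_insert.1 (Finset.mem_of_mem_erase h) with rfl | h
          · rfl
          · exact absurd (hu u (Finset.mem_of_mem_erase h) hau) (Finset.ne_of_mem_erase h)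
      · refine ⟨t, ⟨?_, hat⟩, ?_⟩
        · exact Finset.mem_erase.2 ⟨Finset.ne_empty_of_mem hat,
            Finset.mem_insert_of_mem (Finset.mem_erase.2 ⟨htC, ht⟩)⟩
        · rintro u ⟨h, hau⟩
          rcases Finset.mem_insert.1 (Finset.mem_of_mem_erase h) with rfl | h
          · exact absurd (hu C hC (Finset.mem_of_mem_erase hau)).symm htC
          · exact hu u (Finset.mem_of_mem_erase h) hau)
    (Finset.notMem_erase _ _)
  have hP : P.parts = (insert (C.erase s) (Q.parts.erase C)).erase ∅ := rfl
  have hB : C.erase s ∈ insert ∅ P.parts := by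
    rw [hP]
    by_cases h : C.erase s = ∅
    · rw [h]; exact Finset.mem_insert_self _ _
    · exact Finset.mem_insert_of_mem (Finset.mem_erase.2 ⟨h, Finset.mem_insert_self _ _⟩)
  refine ⟨P, C.erase s, hB, ?_⟩
  apply Finpartition.ext
  rw [Finpartition.parts_insertInto, Finset.insert_erase hsC, hP, Finset.erase_right_comm,
    Finset.erase_insert hBn, Finset.erase_eq_of_notMem hempty, Finset.insert_erase hC]

/-- The partitions of `insert s A` arise from the partitions of `A` by adding the part `{s}` or by
inserting `s` into one of the parts. -/
theorem Finpartition.sum_insert {M : Type*} [AddCommMonoid M] {A : Finset S} {s : S} (hs : s ∉ A)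
    (φ : Finset (Finset S) → M) :
    ∑ Q : Finpartition (insert s A), φ Q.parts = ∑ P : Finpartition A,
      (φ (insert {s} P.parts) + ∑ B ∈ P.parts, φ (insert (insert s B) (P.parts.erase B))) := by
  have h1 : ∀ P : Finpartition A,
      φ (insert {s} P.parts) + ∑ B ∈ P.parts, φ (insert (insert s B) (P.parts.erase B)) =
      ∑ B ∈ insert ∅ P.parts, φ (insert (insert s B) (P.parts.erase B)) := by
    intro P
    rw [Finset.sum_insert P.empty_notMem_parts, Finset.erase_eq_of_notMem P.empty_notMem_parts]
    rfl
  simp_rw [h1]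
  rw [Finset.sum_sigma']
  symm
  refine Finset.sum_bij (fun x hx => x.1.insertInto s hs x.2 (Finset.mem_sigma.1 hx).2)
    (fun _ _ => Finset.mem_univ _) ?_ ?_ (fun _ _ => rfl)
  · rintro ⟨P, B⟩ hx ⟨P', B'⟩ hx' h
    have hB := (Finset.mem_sigma.1 hx).2
    have hB' := (Finset.mem_sigma.1 hx').2
    have hparts : insert (insert s B) (P.parts.erase B) =
        insert (insert s B') (P'.parts.erase B') := congrArg Finpartition.parts h
    have hsub : ∀ (P : Finpartition A) (B), B ∈ insert ∅ P.parts → B ⊆ A := by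
      intro P B hB
      rcases Finset.mem_insert.1 hB with rfl | h
      · exact Finset.empty_subset _
      · exact P.subset h
    have hnot : ∀ (P : Finpartition A) (B C : Finset S), insert s C ∉ P.parts.erase B :=
      fun P B C h => hs (P.subset (Finset.mem_of_mem_erase h) (Finset.mem_insert_self _ _))
    -- The part containing `s` is unique in the new partition, so it determines `B`.
    have hBB : B = B' := by
      have h2 : insert s B ∈ insert (insert s B') (P'.parts.erase B') :=
        hparts ▸ Finset.mem_insert_self _ _
      have h3 := (Finset.mem_insert.1 h2).resolve_right (hnot _ _ _)
      rw [← Finset.erase_insert (fun h => hs (hsub P B hB h)), h3,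
        Finset.erase_insert (fun h => hs (hsub P' B' hB' h))]
    subst hBB
    have h4 : P.parts.erase B = P'.parts.erase B := by
      rw [← Finset.erase_insert (hnot P B B), hparts, Finset.erase_insert (hnot P' B B)]
    have h5 : P.parts = P'.parts := by
      by_cases hBe : B = ∅
      · subst hBe
        rwa [Finset.erase_eq_of_notMem P.empty_notMem_parts,
          Finset.erase_eq_of_notMem P'.empty_notMem_parts] at h4
      · have m := (Finset.mem_insert.1 hB).resolve_left hBe
        have m' := (Finset.mem_insert.1 hB').resolve_left hBe
        rw [← Finset.insert_erase m, h4, Finset.insert_erase m']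
    rw [Finpartition.ext h5]
  · intro Q _
    obtain ⟨P, B, hB, hQ⟩ := Finpartition.exists_insertInto hs Q
    exact ⟨⟨P, B⟩, Finset.mem_sigma.2 ⟨Finset.mem_univ _, hB⟩, hQ⟩

end Finpartition

namespace FeynmanGraph

/-! ### Derivatives of a power as a sum over set partitions -/

section PartitionSum

variable {S : Type*} [DecidableEq S]

/-- The sum over set partitions in the derivatives of `D ∅ ^ (-β)`, where `D A` stands for the
mixed derivative of `D ∅` in the directions `A`. -/
noncomputable def partitionSum (β : ℝ) (D : Finset S → ℝ) (A : Finset S) : ℝ :=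
  ∑ P : Finpartition A, (-1) ^ (A.card + P.parts.card) * Real.Gamma (β + P.parts.card) *
    D ∅ ^ (-(β + P.parts.card)) * ∏ B ∈ P.parts, D B

/-- By the product rule, the derivative either hits the power of `D ∅` or one of the factors `D B`.
The first creates the part `{s}`, and the factor `β + k` from the exponent raises the argument of
`Γ` by one; the second inserts `s` into `B`. In both cases the signs `(-1)^(#A + k)` combine to the
overall minus sign. -/
theorem hasDerivAt_partitionSum {β : ℝ} (hβ : 0 < β) {D : ℝ → Finset S → ℝ} {A : Finset S} {s : S}
    (hs : s ∉ A) (hD : ∀ B ⊆ A, HasDerivAt (fun t => D t B) (D 0 (insert s B)) 0)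
    (h0 : 0 < D 0 ∅) :
    HasDerivAt (fun t => partitionSum β (D t) A) (-partitionSum β (D 0) (insert s A)) 0 := by
  have hterm : ∀ P : Finpartition A, HasDerivAt
      (fun t => (-1) ^ (A.card + P.parts.card) * Real.Gamma (β + P.parts.card) *
        D t ∅ ^ (-(β + P.parts.card)) * ∏ B ∈ P.parts, D t B)
      ((-1) ^ (A.card + P.parts.card) * Real.Gamma (β + P.parts.card) *
        (D 0 (insert s ∅) * (-(β + P.parts.card)) * D 0 ∅ ^ (-(β + P.parts.card) - 1)) *
          ∏ B ∈ P.parts, D 0 B +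
        (-1) ^ (A.card + P.parts.card) * Real.Gamma (β + P.parts.card) *
          D 0 ∅ ^ (-(β + P.parts.card)) *
        ∑ B ∈ P.parts, (∏ C ∈ P.parts.erase B, D 0 C) • D 0 (insert s B)) 0 := by
    intro P
    have h1 := ((hD ∅ (Finset.empty_subset _)).rpow_const (p := -(β + P.parts.card))
      (Or.inl h0.ne')).const_mul
        ((-1) ^ (A.card + P.parts.card) * Real.Gamma (β + P.parts.card))
    have h2 := HasDerivAt.fun_finsetProd (u := P.parts) (f := fun B t => D t B)
      (f' := fun B => D 0 (insert s B)) (x := 0) (fun B hB => hD B (P.subset hB))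
    exact h1.mul h2
  have hsum := HasDerivAt.fun_sum (u := Finset.univ) fun P _ => hterm P
  refine hsum.congr_deriv ?_
  unfold partitionSum
  rw [Finpartition.sum_insert hs (fun parts => (-1 : ℝ) ^ ((insert s A).card + parts.card) *
    Real.Gamma (β + parts.card) * D 0 ∅ ^ (-(β + parts.card)) * ∏ B ∈ parts, D 0 B),
    ← Finset.sum_neg_distrib]
  refine Finset.sum_congr rfl fun P _ => ?_
  have hnot : ∀ C : Finset S, insert s C ∉ P.parts :=
    fun C h => hs (P.subset h (Finset.mem_insert_self _ _))
  have hnot' : ∀ B C : Finset S, insert s C ∉ P.parts.erase B :=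
    fun B C h => hnot C (Finset.mem_of_mem_erase h)
  refine Eq.trans ?_ (neg_add _ _).symm
  rw [← Finset.sum_neg_distrib, Finset.mul_sum]
  congr 1
  · have hc : (insert {s} P.parts).card = P.parts.card + 1 :=
      Finset.card_insert_of_notMem (hnot ∅)
    rw [hc, Finset.prod_insert (show {s} ∉ P.parts from hnot ∅), Finset.card_insert_of_notMem hs]
    have hG : Real.Gamma (β + (P.parts.card + 1 : ℕ)) =
        (β + P.parts.card) * Real.Gamma (β + P.parts.card) := by
      rw [← Real.Gamma_add_one (by positivity)]
      congr 1
      push_cast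
      ring
    have he : -(β + ((P.parts.card + 1 : ℕ) : ℝ)) = -(β + P.parts.card) - 1 := by
      push_cast; ring
    rw [hG, he, show A.card + 1 + (P.parts.card + 1) = A.card + P.parts.card + 2 by ring, pow_add]
    simp only [insert_empty_eq]
    ring
  · refine Finset.sum_congr rfl fun B hB => ?_
    have hc : (insert (insert s B) (P.parts.erase B)).card = P.parts.card := by
      rw [Finset.card_insert_of_notMem (hnot' B B), Finset.card_erase_add_one hB]
    rw [hc, Finset.prod_insert (hnot' B B), Finset.card_insert_of_notMem hs,
      show A.card + 1 + P.parts.card = A.card + P.parts.card + 1 by ring, pow_succ, smul_eq_mul]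
    ring

lemma partitionSum_empty (β : ℝ) (D : Finset S → ℝ) :
    partitionSum β D ∅ = Real.Gamma β * D ∅ ^ (-β) := by
  unfold partitionSum
  have hu : Unique (Finpartition (∅ : Finset S)) :=
    inferInstanceAs (Unique (Finpartition (⊥ : Finset S)))
  have hp : ∀ P : Finpartition (∅ : Finset S), P.parts = ∅ := fun P =>
    P.parts_eq_empty_iff.2 rfl
  rw [Finset.sum_congr rfl fun P _ => by rw [hp P], Finset.sum_const, Finset.card_univ,
    Fintype.card_unique]
  simp

end PartitionSum

/-! ### The parametric integrand as a partition sum -/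

section Integrand

variable {V E S : Type*} [Fintype V] [DecidableEq V] [Fintype E] [DecidableEq E]
  [Fintype S] [DecidableEq S]

/-- Partitions are grouped by their number of parts `k`. The natural subtraction `#S - k` is exact
because `k ≤ #S`, and it has the parity of `#S + k`. -/
theorem parametricIntegrand_eq_partitionSum (G : FeynmanGraph V E) (v₀ : V) (d : ℕ) (s : S → E × E)
    (a : E → ℝ) (hU : 0 < G.symanzik v₀ a) :
    G.parametricIntegrand v₀ d s a =
      partitionSum ((d : ℝ) / 2) (G.avgRowDet v₀ s (Matrix.diagonal a)) Finset.univ := by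
  unfold parametricIntegrand partitionSum
  have hU' : G.avgRowDet v₀ s (Matrix.diagonal a) ∅ = G.symanzik v₀ a := by
    rw [avgRowDet_empty]; rfl
  rw [hU']
  rw [← Finset.sum_fiberwise_of_maps_to (s := Finset.univ)
    (t := Finset.range (Fintype.card S + 1)) (g := fun P : Finpartition (Finset.univ : Finset S) =>
      P.parts.card)]
  · refine Finset.sum_congr rfl fun k hk => ?_
    rw [Finset.mul_sum]
    refine Finset.sum_congr rfl fun P hP => ?_
    have hPk : P.parts.card = k := (Finset.mem_filter.1 hP).2
    have hk' : k ≤ Fintype.card S := Nat.lt_succ_iff.1 (Finset.mem_range.1 hk)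
    rw [hPk, Real.rpow_neg hU.le, Finset.card_univ,
      show Fintype.card S + k = (Fintype.card S - k) + 2 * k by omega, pow_add, pow_mul,
      neg_one_sq, one_pow, mul_one]
    simp only [avgDodgson_eq_avgRowDet]
    rw [div_eq_mul_inv]
  · intro P _
    rw [Finset.mem_range, Nat.lt_succ_iff]
    exact P.card_parts_le_card

end Integrand

end FeynmanGraph

/-! ### Gaussian integrals over several Euclidean vectors -/

section Gaussian

variable {d L : ℕ}

/-- The action of a matrix on vectors with entries in a Euclidean space. -/
noncomputable def Matrix.vectorAction (d : ℕ) (R : Matrix (Fin L) (Fin L) ℝ) :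
    (Fin L → EuclideanSpace ℝ (Fin d)) →ₗ[ℝ] (Fin L → EuclideanSpace ℝ (Fin d)) where
  toFun k := fun m => ∑ l, R m l • k l
  map_add' x y := by funext m; simp [Finset.sum_add_distrib]
  map_smul' c x := by
    funext m
    simp only [Pi.smul_apply, RingHom.id_apply, Finset.smul_sum]
    exact Finset.sum_congr rfl fun l _ => smul_comm _ _ _

/-- Vectors with entries in a Euclidean space, as functions of both indices. -/
noncomputable def euclideanUncurry (d L : ℕ) :
    (Fin L → EuclideanSpace ℝ (Fin d)) ≃ₗ[ℝ] (Fin L × Fin d → ℝ) :=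
  (LinearEquiv.piCongrRight fun _ => WithLp.linearEquiv 2 ℝ (Fin d → ℝ)).trans
    (LinearEquiv.curry ℝ ℝ (Fin L) (Fin d)).symm

/-- In coordinates the map is the Kronecker product of `R` with the identity of size `d`. -/
lemma Matrix.det_vectorAction (R : Matrix (Fin L) (Fin L) ℝ) :
    LinearMap.det (R.vectorAction d) = R.det ^ d := by
  have h : (euclideanUncurry d L : _ →ₗ[ℝ] _) ∘ₗ R.vectorAction d ∘ₗ
      ((euclideanUncurry d L).symm : _ →ₗ[ℝ] _) =
      Matrix.toLin' (Matrix.kroneckerMap (· * ·) R (1 : Matrix (Fin d) (Fin d) ℝ)) := by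
    apply LinearMap.ext
    intro x
    funext ⟨m, i⟩
    simp [euclideanUncurry, Matrix.vectorAction, Matrix.mulVec, dotProduct, Fintype.sum_prod_type,
      Matrix.one_apply, WithLp.ofLp_sum]
  rw [← LinearMap.det_conj (R.vectorAction d) (euclideanUncurry d L), h, LinearMap.det_toLin',
    Matrix.det_kronecker]
  simp

lemma integral_comp_vectorAction (R : Matrix (Fin L) (Fin L) ℝ) (hR : R.det ≠ 0)
    (f : (Fin L → EuclideanSpace ℝ (Fin d)) → ℝ) :
    ∫ k, f (R.vectorAction d k) = (|R.det| ^ d)⁻¹ * ∫ k, f k := by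
  have hdet : LinearMap.det (R.vectorAction d) ≠ 0 := by
    rw [Matrix.det_vectorAction]; exact pow_ne_zero _ hR
  have hm := Measure.map_linearMap_addHaar_eq_smul_addHaar
    (volume : Measure (Fin L → EuclideanSpace ℝ (Fin d))) hdet
  let e := (LinearEquiv.ofIsUnitDet (f := R.vectorAction d) (v := Module.finBasis ℝ _)
    (v' := Module.finBasis ℝ _) (by
      rw [LinearMap.det_toMatrix]; exact
        hdet.isUnit)).toContinuousLinearEquiv.toHomeomorph.toMeasurableEquiv
  have he : ⇑e = R.vectorAction d := rfl
  have h1 : ∫ k, f (R.vectorAction d k) = ∫ k, f k ∂(Measure.map (R.vectorAction d) volume) := by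
    rw [← he, MeasureTheory.integral_map_equiv]
  rw [h1, hm, integral_smul_measure, Matrix.det_vectorAction, ENNReal.toReal_ofReal (abs_nonneg _),
    abs_inv, abs_pow, smul_eq_mul]

lemma integral_exp_neg_sum_sq :
    ∫ k : Fin L → EuclideanSpace ℝ (Fin d), Real.exp (-∑ l, ‖k l‖ ^ 2) =
      Real.pi ^ ((L : ℝ) * d / 2) := by
  have h1 : ∀ k : Fin L → EuclideanSpace ℝ (Fin d),
      Real.exp (-∑ l, ‖k l‖ ^ 2) = ∏ l, Real.exp (-‖k l‖ ^ 2) := by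
    intro k
    rw [← Real.exp_sum, Finset.sum_neg_distrib]
  simp_rw [h1]
  rw [integral_fintype_prod_volume_eq_pow (fun x : EuclideanSpace ℝ (Fin d) => Real.exp (-‖x‖ ^ 2))]
  have h2 := GaussianFourier.integral_rexp_neg_mul_sq_norm (V := EuclideanSpace ℝ (Fin d))
    (b := 1) one_pos
  simp only [neg_mul, one_mul, div_one, finrank_euclideanSpace, Fintype.card_fin] at h2
  rw [h2, Fintype.card_fin, ← Real.rpow_natCast, ← Real.rpow_mul Real.pi_pos.le]
  congr 1
  ring

open scoped MatrixOrder in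
/-- The Gaussian integral of a positive definite quadratic form on vectors with entries in a
Euclidean space. -/
theorem integral_exp_neg_quadratic {Q : Matrix (Fin L) (Fin L) ℝ} (hQ : Q.PosDef) :
    ∫ k : Fin L → EuclideanSpace ℝ (Fin d),
        Real.exp (-∑ l, ∑ m, Q l m * inner ℝ (k l) (k m)) =
      Real.pi ^ ((L : ℝ) * d / 2) * Q.det ^ (-((d : ℝ) / 2)) := by
  -- A factorization `Q = RᵀR` turns the form into a sum of squares after the substitution by `R`.
  obtain ⟨R, hR⟩ := CStarAlgebra.nonneg_iff_eq_star_mul_self.mp hQ.posSemidef.nonneg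
  have hR' : Q = R.transpose * R := by
    rw [hR, Matrix.star_eq_conjTranspose, Matrix.conjTranspose_eq_transpose_of_trivial]
  have hdet : Q.det = |R.det| ^ 2 := by
    rw [hR', Matrix.det_mul, Matrix.det_transpose, sq_abs, sq]
  have hpos := hQ.det_pos
  have hR0 : R.det ≠ 0 := by
    intro h; rw [hdet, h] at hpos; simp at hpos
  have hq : ∀ k : Fin L → EuclideanSpace ℝ (Fin d),
      ∑ l, ∑ m, Q l m * inner ℝ (k l) (k m) = ∑ j, ‖R.vectorAction d k j‖ ^ 2 := by
    intro k
    have : ∀ j, ‖R.vectorAction d k j‖ ^ 2 =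
        ∑ l, ∑ m, R j l * R j m * inner ℝ (k l) (k m) := by
      intro j
      rw [← real_inner_self_eq_norm_sq]
      simp only [Matrix.vectorAction, LinearMap.coe_mk, AddHom.coe_mk, sum_inner, inner_sum,
        real_inner_smul_left, real_inner_smul_right]
      exact Finset.sum_congr rfl fun l _ => Finset.sum_congr rfl fun m _ => by
        rw [real_inner_comm]; ring
    simp_rw [this]
    symm
    rw [Finset.sum_comm]
    refine Finset.sum_congr rfl fun l _ => ?_
    rw [Finset.sum_comm]
    refine Finset.sum_congr rfl fun m _ => ?_
    rw [hR', Matrix.mul_apply, Finset.sum_mul]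
    rfl
  simp_rw [hq]
  rw [integral_comp_vectorAction R hR0 (fun k => Real.exp (-∑ j, ‖k j‖ ^ 2)),
    integral_exp_neg_sum_sq, mul_comm, hdet, ← Real.rpow_natCast, ← Real.rpow_natCast,
    ← Real.rpow_mul (abs_nonneg _), ← Real.rpow_neg (abs_nonneg _)]
  congr 2
  push_cast
  ring

end Gaussian

namespace FeynmanGraph

variable {V E S : Type*} [Fintype V] [DecidableEq V] [Fintype E] [DecidableEq E]
  [Fintype S] [DecidableEq S]

/-! ### Quadratic forms in the edge momenta and decay of Gaussians -/

section LoopMomentum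

variable {d L : ℕ}

/-- The edge momenta of a vacuum diagram. -/
noncomputable def loopMomentum (b : Fin L → E → ℤ) (k : Fin L → EuclideanSpace ℝ (Fin d)) (e : E) :
    EuclideanSpace ℝ (Fin d) :=
  ∑ l, (b l e : ℝ) • k l

lemma routedMomentum_eq_loopMomentum (b : Fin L → E → ℤ) (k : Fin L → EuclideanSpace ℝ (Fin d)) :
    routedMomentum 0 b 0 k = loopMomentum b k := by
  funext e
  simp [routedMomentum, loopMomentum, Int.cast_smul_eq_zsmul]

lemma continuous_loopMomentum (b : Fin L → E → ℤ) (e : E) :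
    Continuous fun k : Fin L → EuclideanSpace ℝ (Fin d) => loopMomentum b k e := by
  unfold loopMomentum
  fun_prop

/-- The quadratic form in the edge momenta. -/
noncomputable def edgeForm (X : Matrix E E ℝ) (p : E → EuclideanSpace ℝ (Fin d)) : ℝ :=
  ∑ e, ∑ f, X e f * inner ℝ (p e) (p f)

lemma edgeForm_diagonal (a : E → ℝ) (p : E → EuclideanSpace ℝ (Fin d)) :
    edgeForm (Matrix.diagonal a) p = ∑ e, a e * ‖p e‖ ^ 2 := by
  simp [edgeForm, Matrix.diagonal_apply, ite_mul]

lemma edgeForm_add_pairMatrix (X : Matrix E E ℝ) (x : E × E) (t : ℝ)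
    (p : E → EuclideanSpace ℝ (Fin d)) :
    edgeForm (X + t • pairMatrix x) p = edgeForm X p + t * inner ℝ (p x.1) (p x.2) := by
  have h1 : ∀ i j : E, ∑ e, ∑ f, (Matrix.single i j (1 : ℝ)) e f * inner ℝ (p e) (p f) =
      inner ℝ (p i) (p j) := by
    intro i j
    rw [Finset.sum_eq_single i, Finset.sum_eq_single j]
    · simp
    · intro f _ hf; simp [Matrix.single_apply, hf.symm]
    · simp
    · intro e _ he; simp [Matrix.single_apply, he.symm]
    · simp
  have h2 : edgeForm (X + t • pairMatrix x) p = edgeForm X p + t * (1 / 2 *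
      ∑ e, ∑ f, (Matrix.single x.1 x.2 (1 : ℝ)) e f * inner ℝ (p e) (p f) + 1 / 2 *
      ∑ e, ∑ f, (Matrix.single x.2 x.1 (1 : ℝ)) e f * inner ℝ (p e) (p f)) := by
    simp only [edgeForm, pairMatrix, Matrix.add_apply, Matrix.smul_apply, smul_eq_mul,
      Finset.mul_sum, ← Finset.sum_add_distrib]
    refine Finset.sum_congr rfl fun e _ => Finset.sum_congr rfl fun f _ => by ring
  rw [h2, h1, h1, real_inner_comm (p x.1) (p x.2)]
  ring

lemma edgeForm_loopMomentum (X : Matrix E E ℝ) (b : Fin L → E → ℤ)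
    (k : Fin L → EuclideanSpace ℝ (Fin d)) :
    edgeForm X (loopMomentum b k) = ∑ l, ∑ m,
      ((flowMatrix b ℝ).transpose * X * flowMatrix b ℝ) l m * inner ℝ (k l) (k m) := by
  have h1 : ∀ e f, X e f * inner ℝ (loopMomentum b k e) (loopMomentum b k f) =
      ∑ l, ∑ m, (b l e : ℝ) * X e f * b m f * inner ℝ (k l) (k m) := by
    intro e f
    simp only [loopMomentum, sum_inner, inner_sum, real_inner_smul_left, real_inner_smul_right,
      Finset.mul_sum]
    rw [Finset.sum_comm]
    exact Finset.sum_congr rfl fun l _ => Finset.sum_congr rfl fun m _ => by ring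
  simp only [edgeForm, h1]
  have h2 : ∀ l m, ((flowMatrix b ℝ).transpose * X * flowMatrix b ℝ) l m * inner ℝ (k l) (k m) =
      ∑ e, ∑ f, (b l e : ℝ) * X e f * b m f * inner ℝ (k l) (k m) := by
    intro l m
    rw [Matrix.mul_apply, Finset.sum_mul, Finset.sum_comm]
    refine Finset.sum_congr rfl fun f _ => ?_
    rw [Matrix.mul_apply, Finset.sum_mul, Finset.sum_mul]
    rfl
  simp only [h2]
  calc _ = ∑ e, ∑ l, ∑ f, ∑ m, (b l e : ℝ) * X e f * b m f * inner ℝ (k l) (k m) :=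
        Finset.sum_congr rfl fun e _ => Finset.sum_comm
    _ = ∑ l, ∑ e, ∑ f, ∑ m, (b l e : ℝ) * X e f * b m f * inner ℝ (k l) (k m) := Finset.sum_comm
    _ = ∑ l, ∑ e, ∑ m, ∑ f, (b l e : ℝ) * X e f * b m f * inner ℝ (k l) (k m) :=
        Finset.sum_congr rfl fun l _ => Finset.sum_congr rfl fun e _ => Finset.sum_comm
    _ = _ := Finset.sum_congr rfl fun l _ => Finset.sum_comm

/-- Coercive symmetric matrices. -/
def Coercive (ε : ℝ) (X : Matrix E E ℝ) : Prop :=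
  X.IsSymm ∧ ∀ x : E → ℝ, ε * ∑ e, x e ^ 2 ≤ ∑ e, ∑ f, X e f * (x e * x f)

lemma Coercive.le_edgeForm {ε : ℝ} {X : Matrix E E ℝ} (h : Coercive ε X)
    (p : E → EuclideanSpace ℝ (Fin d)) : ε * ∑ e, ‖p e‖ ^ 2 ≤ edgeForm X p := by
  have h1 : ∑ e, ‖p e‖ ^ 2 = ∑ i, ∑ e, p e i ^ 2 := by
    rw [Finset.sum_comm]
    refine Finset.sum_congr rfl fun e _ => ?_
    rw [EuclideanSpace.norm_sq_eq]
    simp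
  have h2 : edgeForm X p = ∑ i, ∑ e, ∑ f, X e f * (p e i * p f i) := by
    rw [Finset.sum_comm]
    refine Finset.sum_congr rfl fun e _ => ?_
    rw [Finset.sum_comm]
    refine Finset.sum_congr rfl fun f _ => ?_
    rw [← Finset.mul_sum, PiLp.inner_apply]
    congr 1
    exact Finset.sum_congr rfl fun i _ => by simp [mul_comm]
  rw [h1, h2, Finset.mul_sum]
  exact Finset.sum_le_sum fun i _ => h.2 fun e => p e i

lemma pairMatrix_form (x : E × E) (y : E → ℝ) :
    ∑ e, ∑ f, pairMatrix x e f * (y e * y f) = y x.1 * y x.2 := by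
  have h := edgeForm_add_pairMatrix (d := 1) 0 x 1 (fun e => EuclideanSpace.single 0 (y e))
  simp only [edgeForm, zero_add, one_smul, one_mul, EuclideanSpace.inner_single_left,
    PiLp.single_apply, Matrix.zero_apply, zero_mul, Finset.sum_const_zero] at h
  simpa using h

lemma abs_mul_le_sum_sq (y : E → ℝ) (i j : E) : |y i * y j| ≤ ∑ e, y e ^ 2 := by
  have hi : y i ^ 2 ≤ ∑ e, y e ^ 2 :=
    Finset.single_le_sum (f := fun e => y e ^ 2) (fun e _ => sq_nonneg _) (Finset.mem_univ i)
  have hj : y j ^ 2 ≤ ∑ e, y e ^ 2 :=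
    Finset.single_le_sum (f := fun e => y e ^ 2) (fun e _ => sq_nonneg _) (Finset.mem_univ j)
  rw [abs_le]
  constructor <;> nlinarith [sq_nonneg (y i + y j), sq_nonneg (y i - y j)]

/-- A product of two coordinates is at most the sum of all squares, so a perturbation of size `ε/2`
costs at most half of the constant. This provides the neighbourhood in which one can differentiate.
-/
lemma Coercive.add_pairMatrix {ε : ℝ} {X : Matrix E E ℝ} (h : Coercive ε X) (x : E × E) {t : ℝ}
    (ht : |t| ≤ ε / 2) : Coercive (ε / 2) (X + t • pairMatrix x) := by
  refine ⟨?_, fun y => ?_⟩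
  · refine h.1.add (Matrix.IsSymm.smul ?_ t)
    unfold pairMatrix Matrix.IsSymm
    rw [Matrix.transpose_add, Matrix.transpose_smul, Matrix.transpose_smul, Matrix.transpose_single,
      Matrix.transpose_single, add_comm]
  · have h1 : ∑ e, ∑ f, (X + t • pairMatrix x) e f * (y e * y f) =
        ∑ e, ∑ f, X e f * (y e * y f) + t * (y x.1 * y x.2) := by
      rw [← pairMatrix_form x y]
      simp only [Matrix.add_apply, Matrix.smul_apply, smul_eq_mul, Finset.mul_sum,
        ← Finset.sum_add_distrib]
      exact Finset.sum_congr rfl fun e _ => Finset.sum_congr rfl fun f _ => by ring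
    rw [h1]
    have h2 := h.2 y
    have h3 := abs_mul_le_sum_sq y x.1 x.2
    have h4 : |t * (y x.1 * y x.2)| ≤ ε / 2 * ∑ e, y e ^ 2 := by
      rw [abs_mul]
      exact mul_le_mul ht h3 (abs_nonneg _) ((abs_nonneg t).trans ht)
    have h5 := (abs_le.1 h4).1
    linarith

lemma exists_coercive_diagonal {a : E → ℝ} (ha : ∀ e, 0 < a e) :
    ∃ ε, 0 < ε ∧ Coercive ε (Matrix.diagonal a) := by
  obtain ⟨ε, hε, hle⟩ : ∃ ε, 0 < ε ∧ ∀ e, ε ≤ a e := by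
    rcases isEmpty_or_nonempty E with h | h
    · exact ⟨1, one_pos, fun e => h.elim e⟩
    · obtain ⟨e₀, he₀⟩ := Finite.exists_min a
      exact ⟨a e₀, ha e₀, he₀⟩
  refine ⟨ε, hε, Matrix.isSymm_diagonal a, fun x => ?_⟩
  simp only [Matrix.diagonal_apply, ite_mul, zero_mul, Finset.sum_ite_eq, Finset.mem_univ, if_true]
  rw [Finset.mul_sum]
  refine Finset.sum_le_sum fun e _ => ?_
  nlinarith [hle e, sq_nonneg (x e)]

/-- Loop momenta are recovered from edge momenta by a left inverse. -/
lemma sum_smul_loopMomentum {b : Fin L → E → ℤ} {D : Matrix (Fin L) E ℤ}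
    (hD : D * flowMatrix b ℤ = 1) (k : Fin L → EuclideanSpace ℝ (Fin d)) (l : Fin L) :
    ∑ e, (D l e : ℝ) • loopMomentum b k e = k l := by
  have h : ∀ m, ∑ e, (D l e : ℝ) * b m e = if l = m then 1 else 0 := by
    intro m
    have := congrFun (congrFun hD l) m
    rw [Matrix.mul_apply, Matrix.one_apply] at this
    have h2 := congrArg (Int.cast : ℤ → ℝ) this
    push_cast at h2
    simpa [flowMatrix] using h2
  simp only [loopMomentum, Finset.smul_sum, smul_smul]
  rw [Finset.sum_comm]
  simp only [← Finset.sum_smul, h, ite_smul, one_smul, zero_smul, Finset.sum_ite_eq,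
    Finset.mem_univ, if_true]

/-- Cauchy–Schwarz for the expression of loop momenta in edge momenta. Thus decay in the edge
momenta is decay in all loop momenta. -/
lemma exists_norm_sq_le {b : Fin L → E → ℤ} {D : Matrix (Fin L) E ℤ}
    (hD : D * flowMatrix b ℤ = 1) :
    ∃ C : ℝ, 0 < C ∧ ∀ k : Fin L → EuclideanSpace ℝ (Fin d),
      C * ∑ l, ‖k l‖ ^ 2 ≤ ∑ e, ‖loopMomentum b k e‖ ^ 2 := by
  set K : ℝ := 1 + ∑ l, ∑ e, (D l e : ℝ) ^ 2 with hK
  have hK0 : 0 < K := by positivity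
  refine ⟨K⁻¹, inv_pos.2 hK0, fun k => ?_⟩
  rw [inv_mul_le_iff₀ hK0]
  have h1 : ∀ l, ‖k l‖ ^ 2 ≤ (∑ e, (D l e : ℝ) ^ 2) * ∑ e, ‖loopMomentum b k e‖ ^ 2 := by
    intro l
    calc ‖k l‖ ^ 2 = ‖∑ e, (D l e : ℝ) • loopMomentum b k e‖ ^ 2 := by
          rw [sum_smul_loopMomentum hD]
      _ ≤ (∑ e, |(D l e : ℝ)| * ‖loopMomentum b k e‖) ^ 2 := by
          gcongr
          refine (norm_sum_le _ _).trans (Finset.sum_le_sum fun e _ => ?_)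
          rw [norm_smul, Real.norm_eq_abs]
      _ ≤ (∑ e, |(D l e : ℝ)| ^ 2) * ∑ e, ‖loopMomentum b k e‖ ^ 2 :=
          Finset.sum_mul_sq_le_sq_mul_sq _ _ _
      _ = _ := by simp only [sq_abs]
  calc ∑ l, ‖k l‖ ^ 2 ≤ ∑ l, (∑ e, (D l e : ℝ) ^ 2) * ∑ e, ‖loopMomentum b k e‖ ^ 2 :=
        Finset.sum_le_sum fun l _ => h1 l
    _ = (∑ l, ∑ e, (D l e : ℝ) ^ 2) * ∑ e, ‖loopMomentum b k e‖ ^ 2 := by rw [Finset.sum_mul]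
    _ ≤ _ := by
        gcongr
        rw [hK]; linarith

lemma integrable_exp_neg_sum_sq {c : ℝ} (hc : 0 < c) :
    Integrable fun k : Fin L → EuclideanSpace ℝ (Fin d) => Real.exp (-(c * ∑ l, ‖k l‖ ^ 2)) := by
  have h1 : ∀ k : Fin L → EuclideanSpace ℝ (Fin d),
      Real.exp (-(c * ∑ l, ‖k l‖ ^ 2)) = ∏ l, Real.exp (-c * ‖k l‖ ^ 2) := by
    intro k
    rw [← Real.exp_sum, Finset.mul_sum, ← Finset.sum_neg_distrib]
    simp
  simp_rw [h1]
  refine Integrable.fintype_prod (f := fun _ (x : EuclideanSpace ℝ (Fin d)) =>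
    Real.exp (-c * ‖x‖ ^ 2)) fun l => ?_
  have h2 := (GaussianFourier.integrable_cexp_neg_mul_sq_norm_add (V := EuclideanSpace ℝ (Fin d))
    (b := (c : ℂ)) (by simpa using hc) 0 0).norm
  refine h2.congr (ae_of_all _ fun x => ?_)
  simp [Complex.norm_exp, ← Complex.ofReal_pow]

/-- Polynomials times Gaussians in the edge momenta are integrable. -/
lemma integrable_pow_mul_exp {b : Fin L → E → ℤ} {D : Matrix (Fin L) E ℤ}
    (hD : D * flowMatrix b ℤ = 1) (n : ℕ) {ε : ℝ} (hε : 0 < ε) :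
    Integrable fun k : Fin L → EuclideanSpace ℝ (Fin d) =>
      (∑ e, ‖loopMomentum b k e‖ ^ 2) ^ n * Real.exp (-(ε * ∑ e, ‖loopMomentum b k e‖ ^ 2)) := by
  obtain ⟨C, hC, hle⟩ := exists_norm_sq_le (d := d) hD
  have hg := (integrable_exp_neg_sum_sq (d := d) (L := L) (c := ε / 2 * C) (by positivity)).const_mul
    ((n.factorial : ℝ) * (2 / ε) ^ n)
  refine hg.mono' ?_ (ae_of_all _ fun k => ?_)
  · apply Continuous.aestronglyMeasurable
    have := continuous_loopMomentum (d := d) b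
    fun_prop
  · set N := ∑ e, ‖loopMomentum b k e‖ ^ 2 with hN
    have hN0 : 0 ≤ N := by positivity
    rw [Real.norm_of_nonneg (by positivity)]
    -- Half of the exponent is spent on absorbing the polynomial.
    have h1 : N ^ n ≤ (n.factorial : ℝ) * (2 / ε) ^ n * Real.exp (ε / 2 * N) := by
      have := Real.pow_div_factorial_le_exp (x := ε / 2 * N) (by positivity) n
      rw [div_le_iff₀ (by positivity), mul_pow] at this
      calc N ^ n = (2 / ε) ^ n * ((ε / 2) ^ n * N ^ n) := by
            rw [← mul_assoc, ← mul_pow]; field_simp; simp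
        _ ≤ (2 / ε) ^ n * (Real.exp (ε / 2 * N) * n.factorial) := by gcongr
        _ = _ := by ring
    calc N ^ n * Real.exp (-(ε * N)) ≤
        ((n.factorial : ℝ) * (2 / ε) ^ n * Real.exp (ε / 2 * N)) * Real.exp (-(ε * N)) := by gcongr
      _ = (n.factorial : ℝ) * (2 / ε) ^ n * Real.exp (-(ε / 2 * N)) := by
          rw [mul_assoc, ← Real.exp_add]; ring_nf
      _ ≤ (n.factorial : ℝ) * (2 / ε) ^ n * Real.exp (-(ε / 2 * C * ∑ l, ‖k l‖ ^ 2)) := by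
          gcongr ?_ * Real.exp ?_
          have := mul_le_mul_of_nonneg_left (hle k) (show 0 ≤ ε / 2 by positivity)
          linarith

end LoopMomentum

end FeynmanGraph

namespace FeynmanGraph

variable {V E S : Type*} [Fintype V] [DecidableEq V] [Fintype E] [DecidableEq E]
  [Fintype S] [DecidableEq S]

/-! ### Gaussian moments by induction over the scalar products -/

section Moments

variable {d L : ℕ}

/-- A product of scalar products of edge momenta times a Gaussian. -/
noncomputable def momentFunction (s : S → E × E) (b : Fin L → E → ℤ) (A : Finset S)
    (X : Matrix E E ℝ) (k : Fin L → EuclideanSpace ℝ (Fin d)) : ℝ :=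
  (∏ t ∈ A, inner ℝ (loopMomentum b k (s t).1) (loopMomentum b k (s t).2)) *
    Real.exp (-edgeForm X (loopMomentum b k))

lemma continuous_momentFunction (s : S → E × E) (b : Fin L → E → ℤ) (A : Finset S)
    (X : Matrix E E ℝ) : Continuous (momentFunction (d := d) s b A X) := by
  have := continuous_loopMomentum (d := d) b
  unfold momentFunction edgeForm
  fun_prop

lemma abs_inner_le_sum_sq (p : E → EuclideanSpace ℝ (Fin d)) (i j : E) :
    |inner ℝ (p i) (p j)| ≤ ∑ e, ‖p e‖ ^ 2 := by
  have h := abs_mul_le_sum_sq (fun e => ‖p e‖) i j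
  rw [abs_of_nonneg (by positivity)] at h
  exact (abs_real_inner_le_norm _ _).trans h

/-- The bound depends on `X` only through its coercivity constant, so it dominates uniformly near a
given matrix. -/
lemma abs_momentFunction_le (s : S → E × E) (b : Fin L → E → ℤ) (A : Finset S) {ε : ℝ}
    {X : Matrix E E ℝ} (hX : Coercive ε X) (k : Fin L → EuclideanSpace ℝ (Fin d)) :
    |momentFunction s b A X k| ≤ (∑ e, ‖loopMomentum b k e‖ ^ 2) ^ A.card *
      Real.exp (-(ε * ∑ e, ‖loopMomentum b k e‖ ^ 2)) := by
  unfold momentFunction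
  rw [abs_mul, Finset.abs_prod, Real.abs_exp]
  gcongr
  · calc _ ≤ ∏ t ∈ A, ∑ e, ‖loopMomentum b k e‖ ^ 2 :=
          Finset.prod_le_prod (fun _ _ => abs_nonneg _) fun t _ => abs_inner_le_sum_sq _ _ _
      _ = _ := by rw [Finset.prod_const]
  · exact hX.le_edgeForm _

lemma integrable_momentFunction (s : S → E × E) {b : Fin L → E → ℤ} {D : Matrix (Fin L) E ℤ}
    (hD : D * flowMatrix b ℤ = 1) (A : Finset S) {ε : ℝ} (hε : 0 < ε) {X : Matrix E E ℝ}
    (hX : Coercive ε X) : Integrable (momentFunction (d := d) s b A X) :=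
  (integrable_pow_mul_exp hD A.card hε).mono'
    (continuous_momentFunction s b A X).aestronglyMeasurable
    (ae_of_all _ fun k => abs_momentFunction_le s b A hX k)

lemma hasDerivAt_momentFunction (s : S → E × E) (b : Fin L → E → ℤ) {A : Finset S} {r : S}
    (hr : r ∉ A) (X : Matrix E E ℝ) (k : Fin L → EuclideanSpace ℝ (Fin d)) (t : ℝ) :
    HasDerivAt (fun t : ℝ => momentFunction s b A (X + t • pairMatrix (s r)) k)
      (-momentFunction s b (insert r A) (X + t • pairMatrix (s r)) k) t := by
  unfold momentFunction
  simp only [edgeForm_add_pairMatrix]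
  set w : ℝ := inner ℝ (loopMomentum b k (s r).1) (loopMomentum b k (s r).2) with hw
  have h1 : HasDerivAt (fun t : ℝ => -(edgeForm X (loopMomentum b k) + t * w)) (-w) t := by
    have := (((hasDerivAt_id t).mul_const w).const_add (edgeForm X (loopMomentum b k))).neg
    exact this.congr_deriv (by simp)
  have h2 := (h1.exp).const_mul
    (∏ t ∈ A, inner ℝ (loopMomentum b k (s t).1) (loopMomentum b k (s t).2))
  refine h2.congr_deriv ?_
  rw [Finset.prod_insert hr]
  ring

/-- Differentiating a Gaussian moment in the matrix produces the next moment. -/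
theorem hasDerivAt_integral_momentFunction (s : S → E × E) {b : Fin L → E → ℤ}
    {D : Matrix (Fin L) E ℤ} (hD : D * flowMatrix b ℤ = 1) {A : Finset S} {r : S} (hr : r ∉ A)
    {ε : ℝ} (hε : 0 < ε) {X : Matrix E E ℝ} (hX : Coercive ε X) :
    HasDerivAt (fun t : ℝ => ∫ k : Fin L → EuclideanSpace ℝ (Fin d),
        momentFunction s b A (X + t • pairMatrix (s r)) k)
      (-∫ k : Fin L → EuclideanSpace ℝ (Fin d), momentFunction s b (insert r A) X k) 0 := by
  have h := hasDerivAt_integral_of_dominated_loc_of_deriv_le (μ := volume)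
    (F := fun (t : ℝ) (k : Fin L → EuclideanSpace ℝ (Fin d)) =>
      momentFunction s b A (X + t • pairMatrix (s r)) k)
    (F' := fun (t : ℝ) (k : Fin L → EuclideanSpace ℝ (Fin d)) =>
      -momentFunction s b (insert r A) (X + t • pairMatrix (s r)) k)
    (x₀ := (0 : ℝ)) (s := Metric.ball 0 (ε / 2))
    (bound := fun k => (∑ e, ‖loopMomentum b k e‖ ^ 2) ^ (insert r A).card *
      Real.exp (-(ε / 2 * ∑ e, ‖loopMomentum b k e‖ ^ 2)))
    (Metric.ball_mem_nhds _ (by positivity))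
    (Filter.Eventually.of_forall fun t =>
      (continuous_momentFunction s b A _).aestronglyMeasurable)
    (by simpa using integrable_momentFunction s hD A hε hX)
    (continuous_momentFunction s b _ _).aestronglyMeasurable.neg
    (ae_of_all _ fun k t ht => by
      rw [norm_neg, Real.norm_eq_abs]
      refine abs_momentFunction_le s b _ (hX.add_pairMatrix (s r) ?_) k
      rw [Metric.mem_ball, dist_zero_right, Real.norm_eq_abs] at ht
      exact ht.le)
    (integrable_pow_mul_exp hD _ (by positivity))
    (ae_of_all _ fun k t _ => hasDerivAt_momentFunction s b hr X k t)
  have h2 := h.2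
  simp only [zero_smul, add_zero, integral_neg] at h2
  exact h2

/-- For `d = 1` the form in the edge momenta is the quadratic form of the Gram matrix, so coercivity
and the left inverse `D` bound it below. -/
lemma posDef_gram {b : Fin L → E → ℤ} {D : Matrix (Fin L) E ℤ} (hD : D * flowMatrix b ℤ = 1)
    {ε : ℝ} (hε : 0 < ε) {X : Matrix E E ℝ} (hX : Coercive ε X) :
    ((flowMatrix b ℝ).transpose * X * flowMatrix b ℝ).PosDef := by
  refine Matrix.PosDef.of_dotProduct_mulVec_pos ?_ fun x hx => ?_
  · rw [Matrix.IsHermitian, Matrix.conjTranspose_eq_transpose_of_trivial, Matrix.transpose_mul,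
      Matrix.transpose_mul, Matrix.transpose_transpose, hX.1.eq, Matrix.mul_assoc]
  · have h1 := edgeForm_loopMomentum (d := 1) X b (fun l => EuclideanSpace.single 0 (x l))
    have h2 := hX.le_edgeForm (loopMomentum b fun l => EuclideanSpace.single (0 : Fin 1) (x l))
    obtain ⟨C, hC, h3⟩ := exists_norm_sq_le (d := 1) hD
    have h4 := h3 fun l => EuclideanSpace.single 0 (x l)
    have h5 : 0 < ∑ l, x l ^ 2 := by
      obtain ⟨l, hl⟩ := Function.ne_iff.1 hx
      exact Finset.sum_pos' (fun _ _ => sq_nonneg _)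
        ⟨l, Finset.mem_univ _, by simpa using (sq_pos_of_ne_zero hl)⟩
    simp only [PiLp.norm_single, Real.norm_eq_abs, sq_abs] at h4
    have h6 : star x ⬝ᵥ ((flowMatrix b ℝ).transpose * X * flowMatrix b ℝ).mulVec x =
        edgeForm X (loopMomentum b fun l => EuclideanSpace.single (0 : Fin 1) (x l)) := by
      rw [h1]
      simp only [dotProduct, Matrix.mulVec, Finset.mul_sum, star_trivial,
        EuclideanSpace.inner_single_left, PiLp.single_apply]
      refine Finset.sum_congr rfl fun l _ => Finset.sum_congr rfl fun m _ => ?_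
      simp
      ring
    rw [h6]
    have h7 := mul_le_mul_of_nonneg_left h4 hε.le
    have : 0 < ε * (C * ∑ l, x l ^ 2) := by positivity
    linarith

/-- Both sides obey the same rule when differentiated along `pairMatrix (s r)`, and for empty `A`
they agree by the Gaussian integral. The quantification over `ε` and `X` is part of the induction.
-/
theorem integral_momentFunction {G : FeynmanGraph V E} (hG : G.Connected) (v₀ : V) (hd : 0 < d)
    (s : S → E × E) (b : Module.Basis (Fin L) ℤ G.cycles) (A : Finset S) :
    ∀ {ε : ℝ} {X : Matrix E E ℝ}, 0 < ε → Coercive ε X →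
    Real.Gamma ((d : ℝ) / 2) * ∫ k : Fin L → EuclideanSpace ℝ (Fin d),
        momentFunction s (fun l => (b l : E → ℤ)) A X k =
      Real.pi ^ ((L : ℝ) * d / 2) * partitionSum ((d : ℝ) / 2) (G.avgRowDet v₀ s X) A := by
  obtain ⟨-, D, -, -, hD, -, -⟩ := exists_unimodular hG v₀ b
  have hdet : ∀ {ε : ℝ} {X : Matrix E E ℝ}, 0 < ε → Coercive ε X →
      0 < (G.blockMatrix v₀ X).det := fun hε hX => by
    rw [det_blockMatrix hG v₀ b]
    exact (posDef_gram hD hε hX).det_pos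
  induction A using Finset.induction_on with
  | empty =>
    intro ε X hε hX
    rw [partitionSum_empty, avgRowDet_empty, det_blockMatrix hG v₀ b]
    have h := integral_exp_neg_quadratic (d := d) (posDef_gram hD hε hX)
    simp only [momentFunction, Finset.prod_empty, one_mul, edgeForm_loopMomentum]
    rw [h]
    ring
  | insert r A hr ih =>
    intro ε X hε hX
    have h1 := (hasDerivAt_integral_momentFunction (d := d) s hD hr hε hX).const_mul
      (Real.Gamma ((d : ℝ) / 2))
    have h0 : G.avgRowDet v₀ s X = G.avgRowDet v₀ s (X + (0 : ℝ) • pairMatrix (s r)) := by simp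
    have h2 := (hasDerivAt_partitionSum (β := (d : ℝ) / 2)
      (D := fun t => G.avgRowDet v₀ s (X + t • pairMatrix (s r))) (by positivity) hr
      (fun B hB => by
        simp only [← h0]
        exact hasDerivAt_avgRowDet G v₀ s X fun h => hr (hB h))
      (by simp only [← h0]; rw [avgRowDet_empty]; exact hdet hε hX)).const_mul
      (Real.pi ^ ((L : ℝ) * d / 2))
    -- The induction hypothesis is needed on a whole neighbourhood of `t = 0`, where the matrix
    -- stays coercive with constant `ε/2`.
    have heq : (fun t : ℝ => Real.Gamma ((d : ℝ) / 2) *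
        ∫ k : Fin L → EuclideanSpace ℝ (Fin d),
          momentFunction s (fun l => (b l : E → ℤ)) A (X + t • pairMatrix (s r)) k)
        =ᶠ[nhds 0] fun t => Real.pi ^ ((L : ℝ) * d / 2) *
          partitionSum ((d : ℝ) / 2) (G.avgRowDet v₀ s (X + t • pairMatrix (s r))) A := by
      filter_upwards [Metric.ball_mem_nhds (0 : ℝ) (show 0 < ε / 2 by positivity)] with t ht
      rw [Metric.mem_ball, dist_zero_right, Real.norm_eq_abs] at ht
      exact ih (by positivity) (hX.add_pairMatrix (s r) ht.le)
    have h3 := (h2.congr_of_eventuallyEq heq).unique h1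
    simp only [← h0] at h3
    linarith

end Moments

/-! ### The integrand of a vacuum diagram -/

section VacuumIntegrand

variable {d L : ℕ}

lemma schwingerFunction_eq_momentFunction (s : S → E × E) (b : Fin L → E → ℤ) (a : E → ℝ) :
    schwingerFunction (d := d) s b a = momentFunction s b Finset.univ (Matrix.diagonal a) := by
  funext k
  rw [schwingerFunction, momentFunction, routedMomentum_eq_loopMomentum, edgeForm_diagonal,
    numerator]

lemma integrable_schwingerFunction {G : FeynmanGraph V E} (hG : G.Connected) (s : S → E × E)
    (b : Module.Basis (Fin L) ℤ G.cycles) (v₀ : V) {a : E → ℝ} (ha : ∀ e, 0 < a e) :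
    Integrable (schwingerFunction (d := d) s (fun l => (b l : E → ℤ)) a) := by
  obtain ⟨-, D, -, -, hD, -, -⟩ := exists_unimodular hG v₀ b
  obtain ⟨ε, hε, hX⟩ := exists_coercive_diagonal ha
  rw [schwingerFunction_eq_momentFunction]
  exact integrable_momentFunction s hD _ hε hX

theorem vacuumIntegrand_eq_parametricIntegrand {G : FeynmanGraph V E} (hG : G.Connected)
    (hd : 0 < d) (s : S → E × E) (b : Module.Basis (Fin L) ℤ G.cycles) (v₀ : V) {a : E → ℝ}
    (ha : ∀ e, 0 < a e) :
    vacuumIntegrand d s (fun l => (b l : E → ℤ)) a = G.parametricIntegrand v₀ d s a := by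
  obtain ⟨-, D, -, -, hD, -, -⟩ := exists_unimodular hG v₀ b
  obtain ⟨ε, hε, hX⟩ := exists_coercive_diagonal ha
  have hU : 0 < G.symanzik v₀ a := by
    rw [symanzik, graphMatrix_eq_blockMatrix, det_blockMatrix hG v₀ b]
    exact (posDef_gram hD hε hX).det_pos
  rw [parametricIntegrand_eq_partitionSum G v₀ d s a hU, vacuumIntegrand,
    schwingerFunction_eq_momentFunction, mul_right_comm,
    integral_momentFunction hG v₀ hd s b Finset.univ hε hX, Real.rpow_neg Real.pi_pos.le]
  field_simp

end VacuumIntegrand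

end FeynmanGraph

namespace FeynmanGraph

/-! ### From the orthant to a slice -/

section Slice

open scoped ENNReal

variable {E : Type*} [Fintype E] [DecidableEq E]

/-- The open positive orthant. -/
def orthant (E : Type*) : Set (E → ℝ) := {a | ∀ e, 0 < a e}

lemma orthant_eq_pi : orthant E = Set.pi Set.univ fun _ => Set.Ioi (0 : ℝ) := by
  ext a; simp [orthant]

lemma measurableSet_orthant : MeasurableSet (orthant E) := by
  rw [orthant_eq_pi]
  exact MeasurableSet.univ_pi fun _ => measurableSet_Ioi

/-- Completes values on the edges other than `f` by a value at `f`. -/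
def fillValue (f : E) (y : {e : E // e ≠ f} → ℝ) (t : ℝ) : E → ℝ := fun e =>
  if h : e = f then t else y ⟨e, h⟩

lemma measurable_fillValue (f : E) :
    Measurable fun p : ({e : E // e ≠ f} → ℝ) × ℝ => fillValue f p.1 p.2 := by
  refine measurable_pi_lambda _ fun e => ?_
  by_cases h : e = f
  · simp only [fillValue, h, dite_true]; exact measurable_snd
  · simp only [fillValue, h, dite_false]
    exact (measurable_pi_apply _).comp measurable_fst

lemma lintegral_eq_lintegral_fillValue (f : E) {g : (E → ℝ) → ℝ≥0∞} (hg : Measurable g) :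
    ∫⁻ a, g a = ∫⁻ y : {e : E // e ≠ f} → ℝ, ∫⁻ t : ℝ, g (fillValue f y t) := by
  have h1 := (volume_preserving_piEquivPiSubtypeProd (fun _ : E => ℝ) (fun e => e ≠ f)).symm
  have hu : Unique {e : E // ¬ e ≠ f} := ⟨⟨⟨f, by simp⟩⟩, fun e => by
    apply Subtype.ext; simpa using e.2⟩
  have h2 := (volume_preserving_funUnique {e : E // ¬ e ≠ f} ℝ).symm
  rw [← h1.lintegral_comp_emb (MeasurableEquiv.measurableEmbedding _), Measure.volume_eq_prod,
    lintegral_prod]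
  · refine lintegral_congr fun y => ?_
    have h3 := h2.lintegral_comp_emb (MeasurableEquiv.measurableEmbedding _) fun z =>
      g ((MeasurableEquiv.piEquivPiSubtypeProd (fun _ : E => ℝ) fun e => e ≠ f).symm (y, z))
    convert! h3.symm using 1
    · congr!
    · refine lintegral_congr fun t => ?_
      congr 1
      funext e
      by_cases h : e = f
      · subst h
        simp [fillValue, MeasurableEquiv.piEquivPiSubtypeProd, Equiv.piEquivPiSubtypeProd]
      · simp [fillValue, MeasurableEquiv.piEquivPiSubtypeProd, h]
  · exact (hg.comp (MeasurableEquiv.measurable _)).aemeasurable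

lemma lintegral_comp_smul_pi {ι : Type*} [Fintype ι] (g : (ι → ℝ) → ℝ≥0∞) {r : ℝ} (hr : 0 < r) :
    ∫⁻ y, g y = ENNReal.ofReal (r ^ Fintype.card ι) * ∫⁻ x, g (r • x) := by
  have h := Measure.map_addHaar_smul (volume : Measure (ι → ℝ)) hr.ne'
  have h2 : ∫⁻ x, g (r • x) = ∫⁻ y, g y ∂(Measure.map (r • ·) volume) :=
    (lintegral_map_equiv g (Homeomorph.smulOfNeZero r hr.ne').toMeasurableEquiv).symm
  rw [h2, h, lintegral_smul_measure, smul_eq_mul, ← mul_assoc,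
    ← ENNReal.ofReal_mul (by positivity), abs_of_pos (by positivity),
    Module.finrank_fintype_fun_eq_card,
    mul_inv_cancel₀ (by positivity), ENNReal.ofReal_one, one_mul]

lemma measurable_fillSlice (T : Finset E) (f : E) : Measurable (fillSlice T f) := by
  refine measurable_pi_lambda _ fun e => ?_
  by_cases h : e = f
  · simp only [fillSlice, h, dite_true]; fun_prop
  · simp only [fillSlice, h, dite_false]
    exact measurable_pi_apply _

lemma measurableSet_slice (T : Finset E) (f : E) : MeasurableSet (slice T f) :=
  measurable_fillSlice T f measurableSet_orthant

/-- Polar decomposition of an integral over the orthant, with a slice in place of the sphere. -/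
theorem lintegral_orthant (T : Finset E) (f : E) {g : (E → ℝ) → ℝ≥0∞} (hg : Measurable g) :
    ∫⁻ a in orthant E, g a = ∫⁻ x in slice T f, ∫⁻ r in Set.Ioi (0 : ℝ),
      ENNReal.ofReal (r ^ (Fintype.card E - 1)) * g (r • fillSlice T f x) := by
  set h : (E → ℝ) → ℝ≥0∞ := (orthant E).indicator g with hh
  have hm : Measurable h := hg.indicator measurableSet_orthant
  set σ : ({e : E // e ≠ f} → ℝ) → ℝ := fun y => ∑ e' : {e : E // e ≠ f} with e'.1 ∈ T, y e' with hσ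
  have hσm : Measurable σ := by fun_prop
  have hcard : Fintype.card {e : E // e ≠ f} = Fintype.card E - 1 := by
    simp [Fintype.card_subtype_compl]
  rw [← lintegral_indicator measurableSet_orthant, ← hh, lintegral_eq_lintegral_fillValue f hm]
  -- The radial variable is `r = t + σ y`, with `t` the parameter of `f`. It is positive on the
  -- orthant, so `r ≤ 0` contributes nothing.
  have h1 : ∀ y : {e : E // e ≠ f} → ℝ, ∫⁻ t : ℝ, h (fillValue f y t) =
      ∫⁻ r in Set.Ioi (0 : ℝ), h (fillValue f y (r - σ y)) := by
    intro y
    rw [← lintegral_sub_right_eq_self (fun t => h (fillValue f y t)) (σ y),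
      ← lintegral_indicator measurableSet_Ioi]
    refine lintegral_congr fun r => ?_
    by_cases hr : 0 < r
    · rw [Set.indicator_of_mem (Set.mem_Ioi.2 hr)]
    · rw [Set.indicator_of_notMem (by simpa using hr), hh, Set.indicator_of_notMem]
      intro ho
      have h2 := ho f
      simp only [fillValue, dite_true] at h2
      have h3 : 0 ≤ σ y := Finset.sum_nonneg fun e _ => by
        have := ho e.1
        simp only [fillValue, e.2, dite_false] at this
        exact this.le
      linarith
  simp_rw [h1]
  have hmeas : Measurable fun p : ({e : E // e ≠ f} → ℝ) × ℝ =>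
      h (fillValue f p.1 (p.2 - σ p.1)) :=
    hm.comp ((measurable_fillValue f).comp (measurable_fst.prodMk
      (measurable_snd.sub (hσm.comp measurable_fst))))
  rw [lintegral_lintegral_swap hmeas.aemeasurable]
  -- For fixed `r` the substitution `y = r x` gives the Jacobian `r^(#E - 1)`.
  have h2 : ∀ r ∈ Set.Ioi (0 : ℝ), ∫⁻ y : {e : E // e ≠ f} → ℝ, h (fillValue f y (r - σ y)) =
      ∫⁻ x in slice T f, ENNReal.ofReal (r ^ (Fintype.card E - 1)) * g (r • fillSlice T f x) := by
    intro r hr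
    have hr' : 0 < r := hr
    rw [lintegral_comp_smul_pi _ hr', hcard, ← lintegral_const_mul' _ _ ENNReal.ofReal_ne_top,
      ← lintegral_indicator (measurableSet_slice T f)]
    refine lintegral_congr fun x => ?_
    have hx : fillValue f (r • x) (r - σ (r • x)) = r • fillSlice T f x := by
      funext e
      by_cases he : e = f
      · subst he
        simp [fillValue, fillSlice, hσ, ← Finset.mul_sum, mul_sub]
      · simp [fillValue, fillSlice, he]
    rw [hx]
    have hiff : r • fillSlice T f x ∈ orthant E ↔ x ∈ slice T f :=
      forall_congr' fun e => by simp [hr']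
    by_cases hs : x ∈ slice T f
    · rw [Set.indicator_of_mem hs, hh, Set.indicator_of_mem (hiff.2 hs)]
    · rw [Set.indicator_of_notMem hs, hh, Set.indicator_of_notMem (fun h => hs (hiff.1 h)),
        mul_zero]
  rw [setLIntegral_congr_fun measurableSet_Ioi h2]
  refine lintegral_lintegral_swap (Measurable.aemeasurable ?_)
  refine Measurable.mul (by fun_prop) (hg.comp ?_)
  exact measurable_fst.smul ((measurable_fillSlice T f).comp measurable_snd)

lemma lintegral_mul_exp_neg {c : ℝ} (hc : 0 < c) :
    ∫⁻ r in Set.Ioi (0 : ℝ), ENNReal.ofReal (c * Real.exp (-(r * c))) = 1 := by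
  have hi : IntegrableOn (fun r => c * Real.exp (-(r * c))) (Set.Ioi 0) := by
    have := (exp_neg_integrableOn_Ioi 0 hc).const_mul c
    simpa [IntegrableOn, mul_comm] using this
  rw [← ofReal_integral_eq_lintegral_ofReal hi
    (ae_of_all _ fun r => by positivity)]
  have h := Real.integral_rpow_mul_exp_neg_mul_Ioi (a := 1) (r := c) one_pos hc
  simp only [sub_self, Real.rpow_zero, one_mul, Real.rpow_one, Real.Gamma_one, mul_one] at h
  rw [integral_const_mul]
  simp only [mul_comm _ c, h]
  rw [mul_one_div_cancel hc.ne', ENNReal.ofReal_one]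

/-- Integrals of homogeneous functions over a slice, as integrals over the orthant with a
normalizing factor in one coordinate. -/
theorem lintegral_slice_of_homogeneous (T : Finset E) (f e₀ : E) {W : (E → ℝ) → ℝ}
    (hW : Measurable W)
    (hom : ∀ a ∈ orthant E, ∀ r : ℝ, 0 < r → r ^ Fintype.card E * W (r • a) = W a) :
    ∫⁻ a in orthant E, ENNReal.ofReal (W a * (a e₀ * Real.exp (-a e₀))) =
      ∫⁻ x in slice T f, ENNReal.ofReal (W (fillSlice T f x)) := by
  rw [lintegral_orthant T f (by fun_prop)]
  refine setLIntegral_congr_fun (measurableSet_slice T f) fun x hx => ?_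
  have hx0 : 0 < fillSlice T f x e₀ := hx e₀
  set c := fillSlice T f x e₀ with hc
  have hn : Fintype.card E - 1 + 1 = Fintype.card E :=
    Nat.sub_add_cancel (Fintype.card_pos_iff.2 ⟨e₀⟩)
  -- By homogeneity the integrand on the ray through a slice point is `W` there times `c e^(-rc)`,
  -- whose integral is 1 for every `c > 0`.
  have h1 : ∀ r ∈ Set.Ioi (0 : ℝ), ENNReal.ofReal (r ^ (Fintype.card E - 1)) *
      ENNReal.ofReal (W (r • fillSlice T f x) * ((r • fillSlice T f x) e₀ *
        Real.exp (-(r • fillSlice T f x) e₀))) =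
      ENNReal.ofReal (W (fillSlice T f x)) * ENNReal.ofReal (c * Real.exp (-(r * c))) := by
    intro r hr
    have hr' : 0 < r := hr
    rw [← ENNReal.ofReal_mul (by positivity), mul_comm (ENNReal.ofReal (W _)),
      ← ENNReal.ofReal_mul (by positivity), ← hom _ hx r hr',
      show r ^ Fintype.card E = r ^ (Fintype.card E - 1) * r by rw [← pow_succ, hn]]
    simp only [Pi.smul_apply, smul_eq_mul, ← hc]
    congr 1
    ring
  rw [setLIntegral_congr_fun measurableSet_Ioi h1, lintegral_const_mul' _ _ ENNReal.ofReal_ne_top,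
    lintegral_mul_exp_neg hx0, mul_one]

/-- The nonnegative version is used for `W`, `-W` and `|W|`. The right side does not mention the
slice and the left side does not mention `e₀`. -/
theorem integral_slice_of_homogeneous (T : Finset E) (f e₀ : E) {W : (E → ℝ) → ℝ}
    (hW : Measurable W)
    (hom : ∀ a ∈ orthant E, ∀ r : ℝ, 0 < r → r ^ Fintype.card E * W (r • a) = W a)
    (hi : IntegrableOn (fun a => W a * (a e₀ * Real.exp (-a e₀))) (orthant E)) :
    IntegrableOn (fun x => W (fillSlice T f x)) (slice T f) ∧
      ∫ x in slice T f, W (fillSlice T f x) =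
        ∫ a in orthant E, W a * (a e₀ * Real.exp (-a e₀)) := by
  have hpos := lintegral_slice_of_homogeneous T f e₀ hW hom
  have hneg := lintegral_slice_of_homogeneous T f e₀ (W := fun a => -W a) hW.neg
    (fun a ha r hr => by rw [mul_neg, hom a ha r hr])
  have habs := lintegral_slice_of_homogeneous T f e₀ (W := fun a => |W a|) hW.abs
    (fun a ha r hr => by
      rw [← hom a ha r hr, abs_mul, abs_of_pos (pow_pos hr _)])
  have hint : IntegrableOn (fun x => W (fillSlice T f x)) (slice T f) := by
    refine ⟨(hW.comp (measurable_fillSlice T f)).aestronglyMeasurable, ?_⟩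
    rw [hasFiniteIntegral_iff_norm]
    simp only [Real.norm_eq_abs]
    rw [← habs]
    have h2 := (hasFiniteIntegral_iff_norm _).1 hi.2
    refine lt_of_eq_of_lt (setLIntegral_congr_fun measurableSet_orthant fun a ha => ?_) h2
    have ha0 : 0 < a e₀ := ha e₀
    change _ = ENNReal.ofReal ‖_‖
    rw [Real.norm_eq_abs, abs_mul, abs_of_pos (show 0 < a e₀ * Real.exp (-a e₀) by positivity)]
  refine ⟨hint, ?_⟩
  rw [integral_eq_lintegral_pos_part_sub_lintegral_neg_part hint,
    integral_eq_lintegral_pos_part_sub_lintegral_neg_part hi, ← hpos, ← hneg]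
  simp only [neg_mul]

end Slice

end FeynmanGraph

namespace FeynmanGraph

/-! ### Dependence of the cut integral on the exterior momentum -/

section Homogeneity

variable {d L : ℕ}

/-- A reflection exchanges two vectors of equal length; this covers `d = 1` as well. -/
lemma exists_linearIsometryEquiv_smul {q₀ q : EuclideanSpace ℝ (Fin d)} (h₀ : q₀ ≠ 0) (h : q ≠ 0) :
    ∃ ρ : EuclideanSpace ℝ (Fin d) ≃ₗᵢ[ℝ] EuclideanSpace ℝ (Fin d),
      q = (‖q‖ / ‖q₀‖) • ρ q₀ := by
  have h₀' : ‖q₀‖ ≠ 0 := norm_ne_zero_iff.2 h₀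
  have h' : ‖q‖ ≠ 0 := norm_ne_zero_iff.2 h
  have hn : ‖q₀‖ = ‖(‖q₀‖ / ‖q‖) • q‖ := by
    rw [norm_smul, Real.norm_of_nonneg (by positivity)]
    field_simp
  refine ⟨Submodule.reflection (ℝ ∙ (q₀ - (‖q₀‖ / ‖q‖) • q))ᗮ, ?_⟩
  rw [Submodule.reflection_sub hn, smul_smul, div_mul_div_cancel₀ h₀', div_self h', one_smul]

/-- Homogeneity and rotation invariance determine an integral as a function of one vector. -/
theorem integrable_and_integral_of_homogeneous
    {H : EuclideanSpace ℝ (Fin d) → (Fin L → EuclideanSpace ℝ (Fin d)) → ℝ} {m : ℝ}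
    (hscale : ∀ r : ℝ, 0 < r → ∀ q k, H (r • q) (r • k) = r ^ m * H q k)
    (hrot : ∀ ρ : EuclideanSpace ℝ (Fin d) ≃ₗᵢ[ℝ] EuclideanSpace ℝ (Fin d), ∀ q k,
      H (ρ q) (fun l => ρ (k l)) = H q k)
    {q₀ : EuclideanSpace ℝ (Fin d)} (h₀ : q₀ ≠ 0) (hi : Integrable (H q₀)) :
    ∃ C : ℝ, ∀ q, q ≠ 0 → Integrable (H q) ∧
      ∫ k, H q k = C * (‖q‖ ^ 2) ^ ((m + L * d) / 2) := by
  refine ⟨(∫ k, H q₀ k) * (‖q₀‖ ^ 2) ^ (-((m + L * d) / 2)), fun q hq => ?_⟩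
  obtain ⟨ρ, hρ⟩ := exists_linearIsometryEquiv_smul h₀ hq
  have h₀' : 0 < ‖q₀‖ := norm_pos_iff.2 h₀
  have hq' : 0 < ‖q‖ := norm_pos_iff.2 hq
  set r := ‖q‖ / ‖q₀‖ with hr
  have hr0 : 0 < r := div_pos hq' h₀'
  have hρm : MeasurePreserving (fun k : Fin L → EuclideanSpace ℝ (Fin d) => fun l => ρ (k l)) :=
    volume_preserving_pi fun _ => ρ.measurePreserving
  let e : (Fin L → EuclideanSpace ℝ (Fin d)) ≃ᵐ (Fin L → EuclideanSpace ℝ (Fin d)) :=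
    MeasurableEquiv.piCongrRight fun _ => ρ.toMeasurableEquiv
  have he : MeasurePreserving e := hρm
  -- The substitution `k ↦ r ρ k` carries the integral at `q` to the one at `q₀`. The integrand
  -- contributes `r^m` and the measure `r^(Ld)`.
  have hcomp : ∀ k, H q (r • e k) = r ^ m * H q₀ k := by
    intro k
    rw [hρ, hscale r hr0]
    congr 1
    exact hrot ρ q₀ k
  have hfun : (fun k => H q (r • k)) ∘ e = fun k => r ^ m * H q₀ k := funext hcomp
  have hfin : Module.finrank ℝ (Fin L → EuclideanSpace ℝ (Fin d)) = L * d := by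
    rw [Module.finrank_pi_fintype]; simp
  constructor
  · rw [← integrable_comp_smul_iff volume (H q) hr0.ne',
      ← he.integrable_comp_emb e.measurableEmbedding, hfun]
    exact hi.const_mul _
  · have h1 := Measure.integral_comp_smul volume (H q) r
    have h2 : ∫ k, H q (r • k) = r ^ m * ∫ k, H q₀ k := by
      rw [← he.integral_comp e.measurableEmbedding, ← integral_const_mul]
      exact integral_congr_ae (ae_of_all _ hcomp)
    rw [h2, hfin, abs_inv, abs_of_pos (pow_pos hr0 _), smul_eq_mul, eq_inv_mul_iff_mul_eq₀
      (pow_pos hr0 _).ne'] at h1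
    rw [← h1, ← Real.rpow_natCast, ← Real.rpow_natCast, ← Real.rpow_natCast,
      ← Real.rpow_mul hq'.le, ← Real.rpow_mul h₀'.le, ← mul_assoc, ← Real.rpow_add hr0, hr,
      Real.div_rpow hq'.le h₀'.le, show ((2 : ℕ) : ℝ) * -((m + L * d) / 2) = -(m + L * d) by
        push_cast; ring, Real.rpow_neg h₀'.le,
      show ((2 : ℕ) : ℝ) * ((m + L * d) / 2) = (m + L * d) by push_cast; ring,
      show ((L * d : ℕ) : ℝ) + m = m + L * d by push_cast; ring]
    field_simp

end Homogeneity

/-! ### The radial integral -/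

section Radial

/-- The radial weight left over by the Schwinger parameter of the cut edge. -/
noncomputable def radialWeight (β : ℝ) (x : ℝ) : ℝ := β * (1 + x ^ 2) ^ (-(β + 1))

lemma radialWeight_nonneg {β : ℝ} (hβ : 0 < β) (x : ℝ) : 0 ≤ radialWeight β x := by
  unfold radialWeight; positivity

/-- The function `(x²/(1+x²))^β / 2` is an antiderivative and rises from 0 to `1/2`. -/
lemma integral_Ioi_radialWeight {β : ℝ} (hβ : 0 < β) :
    IntegrableOn (fun x => x ^ (2 * β - 1) * radialWeight β x) (Set.Ioi 0) ∧
      ∫ x in Set.Ioi (0 : ℝ), x ^ (2 * β - 1) * radialWeight β x = 1 / 2 := by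
  let g : ℝ → ℝ := fun x => (x ^ 2 / (1 + x ^ 2)) ^ β / 2
  have hcont : ContinuousWithinAt g (Set.Ici 0) 0 := by
    apply Continuous.continuousWithinAt
    apply Continuous.div_const
    refine Continuous.rpow_const ?_ fun x => Or.inr hβ.le
    exact (continuous_pow 2).div (by fun_prop) fun x => by positivity
  have hder : ∀ x ∈ Set.Ioi (0 : ℝ), HasDerivAt g (x ^ (2 * β - 1) * radialWeight β x) x := by
    intro x hx
    have hx' : 0 < x := hx
    have h1 : HasDerivAt (fun x : ℝ => x ^ 2 / (1 + x ^ 2))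
        ((2 * x * (1 + x ^ 2) - x ^ 2 * (2 * x)) / (1 + x ^ 2) ^ 2) x := by
      have ha : HasDerivAt (fun x : ℝ => x ^ 2) (2 * x) x := by
        simpa using hasDerivAt_pow 2 x
      exact ha.div (ha.const_add 1) (by positivity)
    have h2 := (h1.rpow_const (p := β) (Or.inl (by positivity))).div_const 2
    refine h2.congr_deriv ?_
    rw [Real.div_rpow (by positivity) (by positivity), ← Real.rpow_natCast x 2,
      ← Real.rpow_mul hx'.le]
    unfold radialWeight
    have e1 : x ^ (((2 : ℕ) : ℝ) * (β - 1)) = x ^ (2 * β - 1) / x := by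
      rw [div_eq_mul_inv, ← Real.rpow_neg_one x, ← Real.rpow_add hx']
      congr 1; push_cast; ring
    have e2 : (1 + x ^ 2) ^ (-(β + 1)) = ((1 + x ^ 2) ^ (β - 1))⁻¹ / (1 + x ^ 2) ^ 2 := by
      have hp : (0 : ℝ) < 1 + x ^ 2 := by positivity
      rw [← Real.rpow_neg hp.le, div_eq_mul_inv, ← Real.rpow_natCast (1 + x ^ 2) 2,
        ← Real.rpow_neg hp.le, ← Real.rpow_add hp]
      congr 1; push_cast; ring
    rw [e1, Real.rpow_natCast, e2]
    field_simp
    ring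
  have hpos : ∀ x ∈ Set.Ioi (0 : ℝ), 0 ≤ x ^ (2 * β - 1) * radialWeight β x := fun x hx =>
    mul_nonneg (Real.rpow_nonneg (le_of_lt hx) _) (radialWeight_nonneg hβ x)
  have hlim : Filter.Tendsto g Filter.atTop (nhds (1 / 2)) := by
    have h1 : Filter.Tendsto (fun x : ℝ => x ^ 2 / (1 + x ^ 2)) Filter.atTop (nhds 1) := by
      have h2 : Filter.Tendsto (fun x : ℝ => 1 - (1 + x ^ 2)⁻¹) Filter.atTop (nhds (1 - 0)) := by
        refine tendsto_const_nhds.sub (tendsto_inv_atTop_zero.comp ?_)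
        exact Filter.tendsto_atTop_add_const_left _ _ (Filter.tendsto_pow_atTop two_ne_zero)
      rw [sub_zero] at h2
      refine h2.congr fun x => ?_
      have : (1 + x ^ 2 : ℝ) ≠ 0 := by positivity
      field_simp
      ring
    have h3 := (h1.rpow_const (p := β) (Or.inl one_ne_zero)).div_const 2
    simpa using h3
  have hg0 : g 0 = 0 := by simp [g, hβ.ne']
  refine ⟨integrableOn_Ioi_deriv_of_nonneg hcont hder hpos hlim, ?_⟩
  rw [integral_Ioi_of_hasDerivAt_of_nonneg hcont hder hpos hlim, hg0, sub_zero]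

/-- In polar coordinates this is half the area of the unit sphere. The value does not depend on `β`
and accounts for the factor `Γ(d/2)` in the parametric integrand. -/
theorem integral_radialWeight {d : ℕ} (hd : 0 < d) {β : ℝ} (hβ : 0 < β) :
    Integrable (fun q : EuclideanSpace ℝ (Fin d) =>
      (‖q‖ ^ 2) ^ (β - (d : ℝ) / 2) * radialWeight β ‖q‖) ∧
      ∫ q : EuclideanSpace ℝ (Fin d), (‖q‖ ^ 2) ^ (β - (d : ℝ) / 2) * radialWeight β ‖q‖ =
        Real.pi ^ ((d : ℝ) / 2) / Real.Gamma ((d : ℝ) / 2) := by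
  have : Nonempty (Fin d) := ⟨⟨0, hd⟩⟩
  have : Nontrivial (EuclideanSpace ℝ (Fin d)) := by
    apply Module.nontrivial_of_finrank_pos (R := ℝ); simpa using hd
  obtain ⟨h1, h2⟩ := integral_Ioi_radialWeight hβ
  have heq : Set.EqOn (fun x : ℝ => x ^ (2 * β - 1) * radialWeight β x)
      (fun y => y ^ (d - 1) • ((y ^ 2) ^ (β - (d : ℝ) / 2) * radialWeight β y)) (Set.Ioi 0) := by
    intro x hx
    have hx' : 0 < x := hx
    simp only [smul_eq_mul]
    rw [← mul_assoc, ← Real.rpow_natCast x 2, ← Real.rpow_mul hx'.le, ← Real.rpow_natCast x (d - 1),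
      ← Real.rpow_add hx']
    congr 2
    rw [Nat.cast_sub hd]
    push_cast
    ring
  have hfin : Module.finrank ℝ (EuclideanSpace ℝ (Fin d)) = d := by simp
  constructor
  · rw [integrable_fun_norm_addHaar volume
      (f := fun x => (x ^ 2) ^ (β - (d : ℝ) / 2) * radialWeight β x), hfin]
    exact h1.congr_fun heq measurableSet_Ioi
  · rw [integral_fun_norm_addHaar volume
      (fun x => (x ^ 2) ^ (β - (d : ℝ) / 2) * radialWeight β x), hfin,
      ← setIntegral_congr_fun measurableSet_Ioi heq, h2, Measure.real, EuclideanSpace.volume_ball]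
    have hd' : (0 : ℝ) < (d : ℝ) / 2 := by positivity
    rw [Fintype.card_fin, Real.Gamma_add_one hd'.ne', ENNReal.ofReal_one, one_pow, one_mul,
      ENNReal.toReal_ofReal (by have := Real.Gamma_pos_of_pos hd'; positivity),
      Real.sqrt_eq_rpow, ← Real.rpow_natCast, ← Real.rpow_mul Real.pi_pos.le, nsmul_eq_mul,
      smul_eq_mul, show (1 : ℝ) / 2 * d = d / 2 by ring]
    have := (Real.Gamma_pos_of_pos hd').ne'
    field_simp

end Radial

end FeynmanGraph

namespace FeynmanGraph

variable {V E S : Type*} [Fintype V] [DecidableEq V] [Fintype E] [DecidableEq E]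
  [Fintype S] [DecidableEq S]

/-! ### Homogeneity in the Schwinger parameters -/

section Scaling

variable {d L : ℕ}

lemma numerator_smul (s : S → E × E) (p : E → EuclideanSpace ℝ (Fin d)) (r : ℝ) :
    numerator s (fun e => r • p e) = (r ^ 2) ^ Fintype.card S * numerator s p := by
  simp only [numerator, real_inner_smul_left, real_inner_smul_right, ← mul_assoc, ← sq,
    Finset.prod_mul_distrib, Finset.prod_const, Finset.card_univ]

lemma loopMomentum_smul (b : Fin L → E → ℤ) (k : Fin L → EuclideanSpace ℝ (Fin d)) (r : ℝ) :
    loopMomentum b (r • k) = fun e => r • loopMomentum b k e := by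
  funext e
  simp only [loopMomentum, Finset.smul_sum, Pi.smul_apply]
  exact Finset.sum_congr rfl fun l _ => smul_comm _ _ _

lemma schwingerFunction_smul (s : S → E × E) (b : Fin L → E → ℤ) (a : E → ℝ) {r : ℝ} (hr : 0 < r)
    (k : Fin L → EuclideanSpace ℝ (Fin d)) :
    r ^ Fintype.card S * schwingerFunction s b (r • a) k =
      schwingerFunction s b a (Real.sqrt r • k) := by
  unfold schwingerFunction
  rw [routedMomentum_eq_loopMomentum, routedMomentum_eq_loopMomentum, loopMomentum_smul,
    numerator_smul, Real.sq_sqrt hr.le, mul_assoc]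
  congr 4
  refine Finset.sum_congr rfl fun e _ => ?_
  rw [norm_smul, mul_pow, Real.norm_eq_abs, sq_abs, Real.sq_sqrt hr.le, Pi.smul_apply, smul_eq_mul]
  ring

/-- Rescaling the loop momenta by `√r` undoes a rescaling of the parameters by `r`. -/
lemma vacuumIntegrand_smul (s : S → E × E) (b : Fin L → E → ℤ) (a : E → ℝ) {r : ℝ} (hr : 0 < r) :
    r ^ ((Fintype.card S : ℝ) + L * d / 2) * vacuumIntegrand d s b (r • a) =
      vacuumIntegrand d s b a := by
  have h1 := Measure.integral_comp_smul volume (schwingerFunction (d := d) s b a) (Real.sqrt r)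
  simp_rw [← schwingerFunction_smul s b a hr] at h1
  have hfin : Module.finrank ℝ (Fin L → EuclideanSpace ℝ (Fin d)) = L * d := by
    rw [Module.finrank_pi_fintype]; simp
  have hs : 0 < Real.sqrt r := Real.sqrt_pos.2 hr
  rw [integral_const_mul, hfin, abs_inv, abs_of_pos (pow_pos hs _), smul_eq_mul,
    eq_inv_mul_iff_mul_eq₀ (pow_pos hs _).ne'] at h1
  have h2 : Real.sqrt r ^ (L * d) = r ^ ((L : ℝ) * d / 2) := by
    rw [Real.sqrt_eq_rpow, ← Real.rpow_natCast, ← Real.rpow_mul hr.le]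
    congr 1; push_cast; ring
  unfold vacuumIntegrand
  rw [← h1, h2, Real.rpow_add hr, Real.rpow_natCast]
  ring

lemma measurable_parametricIntegrand (G : FeynmanGraph V E) (v₀ : V) (s : S → E × E) :
    Measurable (G.parametricIntegrand v₀ d s) := by
  have hblock : Continuous fun a : E → ℝ => G.blockMatrix v₀ (Matrix.diagonal a) := by
    unfold blockMatrix
    exact Continuous.matrix_fromBlocks (by fun_prop) continuous_const continuous_const
      continuous_const
  have hU : Measurable (G.symanzik v₀) := by
    apply Continuous.measurable
    exact Continuous.matrix_det hblock
  have hD : ∀ A, Measurable fun a => G.avgDodgson v₀ a s A := by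
    intro A
    apply Continuous.measurable
    simp only [avgDodgson_eq_avgRowDet]
    unfold avgRowDet
    refine continuous_const.mul (continuous_finsetSum _ fun σ _ => ?_)
    exact (continuous_rowDet _ _ A).comp hblock
  unfold parametricIntegrand
  refine Finset.measurable_fun_sum _ fun n _ => Measurable.mul ?_ ?_
  · exact measurable_const.div (hU.pow_const _)
  · exact Finset.measurable_fun_sum _ fun P _ => Finset.measurable_fun_prod _ fun A _ => hD A

lemma measurable_weightedIntegrand (G : FeynmanGraph V E) (v₀ : V) (s : S → E × E) (α : E → ℝ) :
    Measurable (G.weightedIntegrand v₀ d s α) := by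
  have := measurable_parametricIntegrand (d := d) G v₀ s
  unfold weightedIntegrand
  fun_prop

/-- Homogeneity is read off from the momentum integral of (1), so degrees of Dodgson polynomials are
not needed. -/
theorem weightedIntegrand_smul {G : FeynmanGraph V E} (hG : G.Connected) (v₀ : V) (hd : 0 < d)
    (s : S → E × E) (b : Module.Basis (Fin L) ℤ G.cycles) {α : E → ℝ}
    (hα : ∑ e, α e = (L : ℝ) * d / 2 + Fintype.card S) {a : E → ℝ} (ha : a ∈ orthant E) {r : ℝ}
    (hr : 0 < r) :
    r ^ Fintype.card E * G.weightedIntegrand v₀ d s α (r • a) =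
      G.weightedIntegrand v₀ d s α a := by
  have hra : ∀ e, 0 < (r • a) e := fun e => mul_pos hr (ha e)
  unfold weightedIntegrand
  rw [← vacuumIntegrand_eq_parametricIntegrand hG hd s b v₀ hra,
    ← vacuumIntegrand_eq_parametricIntegrand hG hd s b v₀ ha,
    ← vacuumIntegrand_smul s _ a hr]
  have h1 : ∏ e, ((r • a) e ^ (α e - 1) / Real.Gamma (α e)) =
      r ^ (∑ e, (α e - 1)) * ∏ e, (a e ^ (α e - 1) / Real.Gamma (α e)) := by
    rw [Real.rpow_sum_of_pos hr, ← Finset.prod_mul_distrib]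
    refine Finset.prod_congr rfl fun e _ => ?_
    rw [Pi.smul_apply, smul_eq_mul, Real.mul_rpow hr.le (ha e).le, mul_div_assoc]
  rw [h1]
  have h2 : r ^ Fintype.card E * r ^ (∑ e, (α e - 1)) =
      r ^ ((Fintype.card S : ℝ) + L * d / 2) := by
    rw [← Real.rpow_natCast, ← Real.rpow_add hr, Finset.sum_sub_distrib, hα]
    congr 1
    simp
    ring
  rw [← h2]
  ring

end Scaling

/-! ### The cut integral with the exterior momentum integrated -/

section Cut

variable {d L : ℕ}

lemma loopMomentum_cons (c : E → ℤ) (b : Fin L → E → ℤ) (q : EuclideanSpace ℝ (Fin d))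
    (k : Fin L → EuclideanSpace ℝ (Fin d)) :
    loopMomentum (Fin.cons c b : Fin (L + 1) → E → ℤ)
      (Fin.cons q k : Fin (L + 1) → EuclideanSpace ℝ (Fin d)) = routedMomentum c b q k := by
  funext e
  simp [loopMomentum, routedMomentum, Fin.sum_univ_succ, Int.cast_smul_eq_zsmul]

lemma routedMomentum_smul (c : E → ℤ) (b : Fin L → E → ℤ) (q : EuclideanSpace ℝ (Fin d))
    (k : Fin L → EuclideanSpace ℝ (Fin d)) (r : ℝ) :
    routedMomentum c b (r • q) (r • k) = fun e => r • routedMomentum c b q k e := by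
  funext e
  simp only [routedMomentum, smul_add, Finset.smul_sum, Pi.smul_apply]
  rw [smul_comm]
  congr 1
  exact Finset.sum_congr rfl fun l _ => smul_comm _ _ _

lemma routedMomentum_rotate (c : E → ℤ) (b : Fin L → E → ℤ) (q : EuclideanSpace ℝ (Fin d))
    (k : Fin L → EuclideanSpace ℝ (Fin d))
    (ρ : EuclideanSpace ℝ (Fin d) ≃ₗᵢ[ℝ] EuclideanSpace ℝ (Fin d)) :
    routedMomentum c b (ρ q) (fun l => ρ (k l)) = fun e => ρ (routedMomentum c b q k e) := by
  funext e
  simp [routedMomentum]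

lemma cutFunction_smul (s : S → E × E) (α : E → ℝ) (e₀ : E) (c : E → ℤ) (b : Fin L → E → ℤ)
    {r : ℝ} (hr : 0 < r) (q : EuclideanSpace ℝ (Fin d)) (k : Fin L → EuclideanSpace ℝ (Fin d)) :
    cutFunction s α e₀ c b (r • q) (r • k) =
      r ^ (2 * (Fintype.card S : ℝ) - 2 * ∑ e ∈ Finset.univ.erase e₀, α e) *
        cutFunction s α e₀ c b q k := by
  unfold cutFunction
  rw [routedMomentum_smul, numerator_smul]
  have h1 : ∏ e ∈ Finset.univ.erase e₀, (‖r • routedMomentum c b q k e‖ ^ 2) ^ (-α e) =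
      r ^ (∑ e ∈ Finset.univ.erase e₀, -(2 * α e)) *
        ∏ e ∈ Finset.univ.erase e₀, (‖routedMomentum c b q k e‖ ^ 2) ^ (-α e) := by
    rw [Real.rpow_sum_of_pos hr, ← Finset.prod_mul_distrib]
    refine Finset.prod_congr rfl fun e _ => ?_
    rw [norm_smul, mul_pow, Real.norm_eq_abs, sq_abs, Real.mul_rpow (by positivity) (by positivity),
      ← Real.rpow_natCast r 2, ← Real.rpow_mul hr.le]
    congr 2
    push_cast; ring
  rw [h1, sub_eq_add_neg, Real.rpow_add hr, Finset.sum_neg_distrib, ← Finset.mul_sum, ← pow_mul,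
    ← Real.rpow_natCast]
  push_cast
  ring

lemma cutFunction_rotate (s : S → E × E) (α : E → ℝ) (e₀ : E) (c : E → ℤ) (b : Fin L → E → ℤ)
    (ρ : EuclideanSpace ℝ (Fin d) ≃ₗᵢ[ℝ] EuclideanSpace ℝ (Fin d))
    (q : EuclideanSpace ℝ (Fin d)) (k : Fin L → EuclideanSpace ℝ (Fin d)) :
    cutFunction s α e₀ c b (ρ q) (fun l => ρ (k l)) = cutFunction s α e₀ c b q k := by
  unfold cutFunction numerator
  simp only [routedMomentum_rotate, LinearIsometryEquiv.inner_map_map,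
    LinearIsometryEquiv.norm_map]

/-- The absolute value of the integrand scales in the same way. Its constant `C'` serves to prove
joint integrability in `q` and `k`. -/
lemma integrable_cutFunction {s : S → E × E} {α : E → ℝ} {e₀ : E} {c : E → ℤ}
    {b : Fin L → E → ℤ} (hα : ∑ e, α e = ((L : ℝ) + 1) * d / 2 + Fintype.card S)
    {q₀ : EuclideanSpace ℝ (Fin d)} (h₀ : q₀ ≠ 0) (hi : Integrable (cutFunction s α e₀ c b q₀)) :
    ∃ C C' : ℝ, ∀ q : EuclideanSpace ℝ (Fin d), q ≠ 0 → Integrable (cutFunction s α e₀ c b q) ∧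
      ∫ k, cutFunction s α e₀ c b q k = C * (‖q‖ ^ 2) ^ (α e₀ - (d : ℝ) / 2) ∧
      ∫ k, |cutFunction s α e₀ c b q k| = C' * (‖q‖ ^ 2) ^ (α e₀ - (d : ℝ) / 2) := by
  obtain ⟨C, hC⟩ := integrable_and_integral_of_homogeneous
    (H := cutFunction s α e₀ c b) (fun r hr q k => cutFunction_smul s α e₀ c b hr q k)
    (cutFunction_rotate s α e₀ c b) h₀ hi
  obtain ⟨C', hC'⟩ := integrable_and_integral_of_homogeneous
    (H := fun q k => |cutFunction s α e₀ c b q k|)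
    (fun r hr q k => by
      rw [cutFunction_smul s α e₀ c b hr q k, abs_mul, abs_of_pos (Real.rpow_pos_of_pos hr _)])
    (fun ρ q k => by rw [cutFunction_rotate]) h₀ hi.abs
  have he : (2 * (Fintype.card S : ℝ) - 2 * ∑ e ∈ Finset.univ.erase e₀, α e + L * d) / 2 =
      α e₀ - (d : ℝ) / 2 := by
    rw [← Finset.add_sum_erase _ _ (Finset.mem_univ e₀)] at hα
    linarith
  rw [he] at hC hC'
  exact ⟨C, C', fun q hq => ⟨(hC q hq).1, (hC q hq).2, (hC' q hq).2⟩⟩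

/-- The integral over the Schwinger parameters of all edges, as a function of the loop momenta. -/
noncomputable def cutWeight (s : S → E × E) (α : E → ℝ) (e₀ : E) {M : ℕ} (b : Fin M → E → ℤ)
    (k : Fin M → EuclideanSpace ℝ (Fin d)) : ℝ :=
  numerator s (loopMomentum b k) *
    (∏ e ∈ Finset.univ.erase e₀, (‖loopMomentum b k e‖ ^ 2) ^ (-α e)) *
      radialWeight (α e₀) ‖loopMomentum b k e₀‖

lemma measurable_cutWeight (s : S → E × E) (α : E → ℝ) (e₀ : E) {M : ℕ} (b : Fin M → E → ℤ) :
    Measurable (cutWeight (d := d) s α e₀ b) := by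
  have h : ∀ e, Measurable fun k : Fin M → EuclideanSpace ℝ (Fin d) => loopMomentum b k e :=
    fun e => (continuous_loopMomentum b e).measurable
  unfold cutWeight numerator radialWeight
  fun_prop

lemma cutWeight_cons (s : S → E × E) (α : E → ℝ) {e₀ : E} {c : E → ℤ} {b : Fin L → E → ℤ}
    (hc : c e₀ = 1) (hb : ∀ l, b l e₀ = 0) (q : EuclideanSpace ℝ (Fin d))
    (k : Fin L → EuclideanSpace ℝ (Fin d)) :
    cutWeight s α e₀ (Fin.cons c b : Fin (L + 1) → E → ℤ)
      (Fin.cons q k : Fin (L + 1) → EuclideanSpace ℝ (Fin d)) =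
      cutFunction s α e₀ c b q k * radialWeight (α e₀) ‖q‖ := by
  unfold cutWeight cutFunction
  rw [loopMomentum_cons]
  congr 3
  simp [routedMomentum, hc, hb]

/-- Since `c` is 1 on `e₀` and the other flows vanish there, the momentum of `e₀` is `q`. The
integral thus fibres over `q` into cut integrals with weight `radialWeight`. -/
theorem integral_cutWeight (hd : 0 < d) {s : S → E × E} {α : E → ℝ} {e₀ : E} {c : E → ℤ}
    {b : Fin L → E → ℤ} (hc : c e₀ = 1) (hb : ∀ l, b l e₀ = 0) (hpos : 0 < α e₀) {C C' : ℝ}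
    (h : ∀ q : EuclideanSpace ℝ (Fin d), q ≠ 0 → Integrable (cutFunction s α e₀ c b q) ∧
      ∫ k, cutFunction s α e₀ c b q k = C * (‖q‖ ^ 2) ^ (α e₀ - (d : ℝ) / 2) ∧
      ∫ k, |cutFunction s α e₀ c b q k| = C' * (‖q‖ ^ 2) ^ (α e₀ - (d : ℝ) / 2)) :
    Integrable (cutWeight (d := d) s α e₀ (Fin.cons c b : Fin (L + 1) → E → ℤ)) ∧
      ∫ k, cutWeight (d := d) s α e₀ (Fin.cons c b : Fin (L + 1) → E → ℤ) k =
        C * (Real.pi ^ ((d : ℝ) / 2) / Real.Gamma ((d : ℝ) / 2)) := by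
  have : Nonempty (Fin d) := ⟨⟨0, hd⟩⟩
  have : Nontrivial (EuclideanSpace ℝ (Fin d)) := by
    apply Module.nontrivial_of_finrank_pos (R := ℝ); simpa using hd
  have hmp := (volume_preserving_piFinSuccAbove
    (fun _ : Fin (L + 1) => EuclideanSpace ℝ (Fin d)) 0).symm
  set e := (MeasurableEquiv.piFinSuccAbove (fun _ : Fin (L + 1) => EuclideanSpace ℝ (Fin d)) 0).symm
    with he
  have hcons : ∀ p : EuclideanSpace ℝ (Fin d) × (Fin L → EuclideanSpace ℝ (Fin d)),
      cutWeight s α e₀ (Fin.cons c b : Fin (L + 1) → E → ℤ) (e p) =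
        cutFunction s α e₀ c b p.1 p.2 * radialWeight (α e₀) ‖p.1‖ := by
    intro p
    rw [← cutWeight_cons s α hc hb]
    congr 1
    simp [he, MeasurableEquiv.piFinSuccAbove, Fin.consEquiv]
  obtain ⟨hr1, hr2⟩ := integral_radialWeight hd hpos
  have hmeas : Measurable fun p : EuclideanSpace ℝ (Fin d) × (Fin L → EuclideanSpace ℝ (Fin d)) =>
      cutFunction s α e₀ c b p.1 p.2 * radialWeight (α e₀) ‖p.1‖ := by
    simp_rw [← hcons]
    exact (measurable_cutWeight s α e₀ _).comp e.measurable
  have hne : ∀ᵐ q : EuclideanSpace ℝ (Fin d), q ≠ 0 := by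
    simp [ae_iff]
  have hprod : Integrable (fun p : EuclideanSpace ℝ (Fin d) × (Fin L → EuclideanSpace ℝ (Fin d)) =>
      cutFunction s α e₀ c b p.1 p.2 * radialWeight (α e₀) ‖p.1‖) := by
    rw [Measure.volume_eq_prod, integrable_prod_iff hmeas.aestronglyMeasurable]
    constructor
    · filter_upwards [hne] with q hq
      exact (h q hq).1.mul_const _
    · refine (hr1.const_mul C').congr ?_
      filter_upwards [hne] with q hq
      simp only [norm_mul, Real.norm_eq_abs]
      rw [integral_mul_const, (h q hq).2.2, abs_of_nonneg (radialWeight_nonneg hpos _), mul_assoc]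
  constructor
  · rw [← hmp.integrable_comp_emb e.measurableEmbedding]
    exact hprod.congr (ae_of_all _ fun p => (hcons p).symm)
  · rw [← hmp.integral_comp e.measurableEmbedding]
    simp_rw [hcons]
    rw [Measure.volume_eq_prod, integral_prod _ hprod, ← hr2, ← integral_const_mul]
    refine integral_congr_ae ?_
    filter_upwards [hne] with q hq
    rw [integral_mul_const, (h q hq).2.1, mul_assoc]

end Cut

end FeynmanGraph

namespace FeynmanGraph

variable {V E S : Type*} [Fintype V] [DecidableEq V] [Fintype E] [DecidableEq E]
  [Fintype S] [DecidableEq S]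

/-! ### The regularized Schwinger representation and Fubini -/

section SchwingerTrick

variable {d L : ℕ}

lemma integral_schwingerFactor {β z : ℝ} (hβ : 0 < β) (hz : 0 < z) :
    IntegrableOn (fun y => y ^ (β - 1) / Real.Gamma β * Real.exp (-(y * z))) (Set.Ioi 0) ∧
      ∫ y in Set.Ioi 0, y ^ (β - 1) / Real.Gamma β * Real.exp (-(y * z)) = z ^ (-β) := by
  have hΓ := Real.Gamma_pos_of_pos hβ
  have h : ∫ y in Set.Ioi 0, y ^ (β - 1) / Real.Gamma β * Real.exp (-(y * z)) = z ^ (-β) := by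
    have h1 := Real.integral_rpow_mul_exp_neg_mul_Ioi hβ hz
    have h2 : ∀ y : ℝ, y ^ (β - 1) / Real.Gamma β * Real.exp (-(y * z)) =
        (Real.Gamma β)⁻¹ * (y ^ (β - 1) * Real.exp (-(z * y))) := by
      intro y; rw [mul_comm y z]; ring
    simp_rw [h2]
    rw [integral_const_mul, h1, Real.rpow_neg hz.le, one_div, Real.inv_rpow hz.le]
    field_simp
  -- The integral of a function that is not integrable is 0 by convention, so a nonzero value proves
  -- integrability.
  refine ⟨Integrable.of_integral_ne_zero ?_, h⟩
  rw [h]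
  exact (Real.rpow_pos_of_pos hz _).ne'

/-- The extra `y e^(-y)` shifts `β` to `β + 1` and `x²` to `1 + x²`; the prefactor `β` is
`Γ(β+1)/Γ(β)`. -/
lemma integral_radialFactor {β x : ℝ} (hβ : 0 < β) :
    IntegrableOn (fun y => y ^ (β - 1) / Real.Gamma β * Real.exp (-(y * x ^ 2)) *
        (y * Real.exp (-y))) (Set.Ioi 0) ∧
      ∫ y in Set.Ioi 0, y ^ (β - 1) / Real.Gamma β * Real.exp (-(y * x ^ 2)) *
        (y * Real.exp (-y)) = radialWeight β x := by
  have hz : 0 < 1 + x ^ 2 := by positivity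
  obtain ⟨h1, h2⟩ := integral_schwingerFactor (β := β + 1) (by linarith) hz
  have he : Set.EqOn (fun y => β * (y ^ (β + 1 - 1) / Real.Gamma (β + 1) *
      Real.exp (-(y * (1 + x ^ 2)))))
      (fun y => y ^ (β - 1) / Real.Gamma β * Real.exp (-(y * x ^ 2)) * (y * Real.exp (-y)))
      (Set.Ioi 0) := by
    intro y hy
    have hΓ := Real.Gamma_pos_of_pos hβ
    have h3 : y ^ (β + 1 - 1) = y ^ (β - 1) * y := by
      rw [← Real.rpow_add_one (ne_of_gt hy)]; ring_nf
    have h4 : Real.exp (-(y * (1 + x ^ 2))) = Real.exp (-(y * x ^ 2)) * Real.exp (-y) := by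
      rw [← Real.exp_add]; ring_nf
    simp only [h3, h4, Real.Gamma_add_one hβ.ne']
    field_simp
  constructor
  · exact IntegrableOn.congr_fun (h1.const_mul β) he measurableSet_Ioi
  · rw [← setIntegral_congr_fun measurableSet_Ioi he, integral_const_mul, h2, radialWeight]

/-- The factor of an edge in the Schwinger representation, regularized at `e₀`. -/
noncomputable def edgeFactor (α : E → ℝ) (e₀ : E) (p : E → EuclideanSpace ℝ (Fin d)) (e : E)
    (y : ℝ) : ℝ :=
  y ^ (α e - 1) / Real.Gamma (α e) * Real.exp (-(y * ‖p e‖ ^ 2)) *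
    (if e = e₀ then y * Real.exp (-y) else 1)

lemma edgeFactor_nonneg {α : E → ℝ} (hα : ∀ e, 0 < α e) (e₀ : E)
    (p : E → EuclideanSpace ℝ (Fin d)) (e : E) {y : ℝ} (hy : 0 < y) :
    0 ≤ edgeFactor α e₀ p e y := by
  have := Real.Gamma_pos_of_pos (hα e)
  unfold edgeFactor
  split_ifs <;> positivity

lemma integral_edgeFactor {α : E → ℝ} (hα : ∀ e, 0 < α e) (e₀ : E)
    {p : E → EuclideanSpace ℝ (Fin d)} (hp : ∀ e, p e ≠ 0) (e : E) :
    IntegrableOn (edgeFactor α e₀ p e) (Set.Ioi 0) ∧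
      ∫ y in Set.Ioi 0, edgeFactor α e₀ p e y =
        if e = e₀ then radialWeight (α e) ‖p e‖ else (‖p e‖ ^ 2) ^ (-α e) := by
  unfold edgeFactor
  split_ifs
  · exact integral_radialFactor (hα e)
  · simp only [mul_one]
    exact integral_schwingerFactor (hα e) (pow_pos (norm_pos_iff.2 (hp e)) 2)

lemma prod_edgeFactor (α : E → ℝ) (e₀ : E) (p : E → EuclideanSpace ℝ (Fin d)) (a : E → ℝ) :
    ∏ e, edgeFactor α e₀ p e (a e) =
      (∏ e, (a e ^ (α e - 1) / Real.Gamma (α e))) * (a e₀ * Real.exp (-a e₀)) *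
        Real.exp (-∑ e, a e * ‖p e‖ ^ 2) := by
  unfold edgeFactor
  rw [Finset.prod_mul_distrib, Finset.prod_mul_distrib, Finset.prod_ite_eq' Finset.univ e₀,
    ← Real.exp_sum, Finset.sum_neg_distrib]
  simp only [Finset.mem_univ, if_true]
  ring

lemma volume_restrict_orthant : (volume : Measure (E → ℝ)).restrict (orthant E) =
    Measure.pi fun _ : E => (volume : Measure ℝ).restrict (Set.Ioi 0) := by
  rw [orthant_eq_pi, volume_pi, Measure.restrict_pi_pi]

lemma integral_prod_edgeFactor {α : E → ℝ} (hα : ∀ e, 0 < α e) (e₀ : E)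
    {p : E → EuclideanSpace ℝ (Fin d)} (hp : ∀ e, p e ≠ 0) :
    IntegrableOn (fun a : E → ℝ => ∏ e, edgeFactor α e₀ p e (a e)) (orthant E) ∧
      ∫ a in orthant E, ∏ e, edgeFactor α e₀ p e (a e) =
        (∏ e ∈ Finset.univ.erase e₀, (‖p e‖ ^ 2) ^ (-α e)) * radialWeight (α e₀) ‖p e₀‖ := by
  rw [IntegrableOn, volume_restrict_orthant]
  constructor
  · exact Integrable.fintype_prod fun e => (integral_edgeFactor hα e₀ hp e).1
  · rw [integral_fintype_prod_eq_prod (f := fun e => edgeFactor α e₀ p e)]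
    simp_rw [fun e => (integral_edgeFactor hα e₀ hp e).2]
    rw [← Finset.prod_erase_mul _ _ (Finset.mem_univ e₀), if_pos rfl]
    congr 1
    exact Finset.prod_congr rfl fun e he => if_neg (Finset.ne_of_mem_erase he)

/-- The momentum of an edge is a nonzero linear map of the loop momenta, so its kernel is a null
set. -/
lemma ae_loopMomentum_ne_zero (hd : 0 < d) {b : Fin L → E → ℤ} (hb : ∀ e, ∃ l, b l e ≠ 0) :
    ∀ᵐ k : Fin L → EuclideanSpace ℝ (Fin d), ∀ e, loopMomentum b k e ≠ 0 := by
  rw [ae_all_iff]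
  intro e
  let K : Submodule ℝ (Fin L → EuclideanSpace ℝ (Fin d)) :=
    LinearMap.ker (∑ l, (b l e : ℝ) • (LinearMap.proj l :
      (Fin L → EuclideanSpace ℝ (Fin d)) →ₗ[ℝ] EuclideanSpace ℝ (Fin d)))
  have hK : ∀ k, k ∈ K ↔ loopMomentum b k e = 0 := by
    intro k
    simp [K, loopMomentum, LinearMap.sum_apply]
  have hne : K ≠ ⊤ := by
    intro h
    obtain ⟨l, hl⟩ := hb e
    have h1 : (Pi.single l (EuclideanSpace.single ⟨0, hd⟩ 1) :
        Fin L → EuclideanSpace ℝ (Fin d)) ∈ K := h ▸ Submodule.mem_top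
    rw [hK, loopMomentum, Finset.sum_eq_single l (fun m _ hm => by simp [Pi.single_eq_of_ne hm])
      (by simp), Pi.single_eq_same, smul_eq_zero] at h1
    rcases h1 with h1 | h1
    · exact hl (by exact_mod_cast h1)
    · simp at h1
  have := Measure.addHaar_submodule (volume : Measure (Fin L → EuclideanSpace ℝ (Fin d))) K hne
  rw [ae_iff]
  convert this using 2
  ext k
  simp [hK]

/-- Integrating first over the Schwinger parameters and then over the loop momenta gives the
regularized cut integral, in the opposite order the parametric integral. -/
theorem integral_weightedIntegrand {G : FeynmanGraph V E} (hG : G.Connected) (v₀ : V) (hd : 0 < d)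
    (s : S → E × E) (b : Module.Basis (Fin L) ℤ G.cycles) (hb : ∀ e, ∃ l, (b l : E → ℤ) e ≠ 0)
    {α : E → ℝ} (hα : ∀ e, 0 < α e) (e₀ : E)
    (hi : Integrable (cutWeight (d := d) s α e₀ fun l => (b l : E → ℤ))) :
    IntegrableOn (fun a => G.weightedIntegrand v₀ d s α a * (a e₀ * Real.exp (-a e₀)))
      (orthant E) ∧
    ∫ a in orthant E, G.weightedIntegrand v₀ d s α a * (a e₀ * Real.exp (-a e₀)) =
      Real.Gamma ((d : ℝ) / 2) * Real.pi ^ (-((L : ℝ) * d / 2)) *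
        ∫ k, cutWeight (d := d) s α e₀ (fun l => (b l : E → ℤ)) k := by
  set b' : Fin L → E → ℤ := fun l => (b l : E → ℤ) with hb'
  set Φ : (E → ℝ) × (Fin L → EuclideanSpace ℝ (Fin d)) → ℝ := fun x =>
    numerator s (loopMomentum b' x.2) * ∏ e, edgeFactor α e₀ (loopMomentum b' x.2) e (x.1 e)
    with hΦ
  have hmeas : Measurable Φ := by
    have h : ∀ e, Measurable fun k : Fin L → EuclideanSpace ℝ (Fin d) => loopMomentum b' k e :=
      fun e => (continuous_loopMomentum b' e).measurable
    have h' : ∀ e, Measurable fun x : (E → ℝ) × (Fin L → EuclideanSpace ℝ (Fin d)) =>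
        loopMomentum b' x.2 e := fun e => (h e).comp measurable_snd
    have h'' : ∀ e, Measurable fun x : (E → ℝ) × (Fin L → EuclideanSpace ℝ (Fin d)) =>
        x.1 e := fun e => (measurable_pi_apply e).comp measurable_fst
    simp only [hΦ, prod_edgeFactor]
    unfold numerator
    fun_prop
  have hae : ∀ᵐ k : Fin L → EuclideanSpace ℝ (Fin d), ∀ e, loopMomentum b' k e ≠ 0 :=
    ae_loopMomentum_ne_zero hd hb
  -- The edge factors are nonnegative, so integrating `|Φ|` over the parameters gives `|cutWeight|`,
  -- which is integrable by assumption.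
  have hint : Integrable Φ ((volume.restrict (orthant E)).prod volume) := by
    rw [integrable_prod_iff' hmeas.aestronglyMeasurable]
    constructor
    · filter_upwards [hae] with k hk
      exact (integral_prod_edgeFactor hα e₀ hk).1.const_mul (numerator s (loopMomentum b' k))
    · refine hi.norm.congr ?_
      filter_upwards [hae] with k hk
      have h1 : ∀ a ∈ orthant E, ‖Φ (a, k)‖ = |numerator s (loopMomentum b' k)| *
          ∏ e, edgeFactor α e₀ (loopMomentum b' k) e (a e) := by
        intro a ha
        rw [Real.norm_eq_abs, abs_mul, abs_of_nonneg
          (Finset.prod_nonneg fun e _ => edgeFactor_nonneg hα e₀ _ e (ha e))]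
      rw [setIntegral_congr_fun measurableSet_orthant h1, integral_const_mul,
        (integral_prod_edgeFactor hα e₀ hk).2, cutWeight, mul_assoc, norm_mul, Real.norm_eq_abs]
      congr 1
      exact abs_of_nonneg (mul_nonneg (Finset.prod_nonneg fun e _ => by positivity)
        (radialWeight_nonneg (hα e₀) _))
  -- For fixed parameters the momentum integral is the vacuum integrand of (1).
  have hinner : ∀ a ∈ orthant E, ∫ k, Φ (a, k) =
      (Real.Gamma ((d : ℝ) / 2) * Real.pi ^ (-((L : ℝ) * d / 2)))⁻¹ *
        (G.weightedIntegrand v₀ d s α a * (a e₀ * Real.exp (-a e₀))) := by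
    intro a ha
    have h1 : ∀ k, Φ (a, k) = (∏ e, (a e ^ (α e - 1) / Real.Gamma (α e))) *
        (a e₀ * Real.exp (-a e₀)) * schwingerFunction s b' a k := by
      intro k
      simp only [hΦ, prod_edgeFactor, schwingerFunction, routedMomentum_eq_loopMomentum]
      ring
    have hκ : Real.Gamma ((d : ℝ) / 2) * Real.pi ^ (-((L : ℝ) * d / 2)) ≠ 0 :=
      (mul_pos (Real.Gamma_pos_of_pos (by positivity)) (Real.rpow_pos_of_pos Real.pi_pos _)).ne'
    simp_rw [h1]
    rw [integral_const_mul, weightedIntegrand,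
      ← vacuumIntegrand_eq_parametricIntegrand hG hd s b v₀ ha, vacuumIntegrand,
      eq_inv_mul_iff_mul_eq₀ hκ]
    ring
  have hκ : Real.Gamma ((d : ℝ) / 2) * Real.pi ^ (-((L : ℝ) * d / 2)) ≠ 0 :=
    (mul_pos (Real.Gamma_pos_of_pos (by positivity)) (Real.rpow_pos_of_pos Real.pi_pos _)).ne'
  constructor
  · have h1 : IntegrableOn (fun a => ∫ k, Φ (a, k)) (orthant E) := hint.integral_prod_left
    have h2 := (h1.congr_fun hinner measurableSet_orthant).const_mul
      (Real.Gamma ((d : ℝ) / 2) * Real.pi ^ (-((L : ℝ) * d / 2)))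
    refine h2.congr (ae_of_all _ fun a => ?_)
    simp only
    rw [mul_inv_cancel_left₀ hκ]
  · have h1 := integral_integral_swap (f := fun a k => Φ (a, k)) hint
    rw [setIntegral_congr_fun measurableSet_orthant hinner, integral_const_mul,
      inv_mul_eq_iff_eq_mul₀ hκ] at h1
    rw [h1]
    congr 1
    refine integral_congr_ae ?_
    filter_upwards [hae] with k hk
    simp only [hΦ]
    rw [integral_const_mul, (integral_prod_edgeFactor hα e₀ hk).2, cutWeight, mul_assoc]

end SchwingerTrick

/-! ### The residue of a vacuum diagram -/

section Residue

variable {d L : ℕ}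

/-- Subtracting `z e₀` times `c` from a cycle `z` makes it avoid `e₀`, so `c` completes `b` to a
basis. -/
lemma exists_basis_cycles {G : FeynmanGraph V E} {e₀ : E} {c : E → ℤ} (hc : c ∈ G.cycles)
    (hc₀ : c e₀ = 1) (b : Module.Basis (Fin L) ℤ (G.cyclesAvoiding e₀)) :
    ∃ B : Module.Basis (Fin (L + 1)) ℤ G.cycles,
      (fun l => (B l : E → ℤ)) = Fin.cons c fun l => (b l : E → ℤ) := by
  have hle : G.cyclesAvoiding e₀ ≤ G.cycles := inf_le_left
  refine ⟨Module.Basis.mkFinConsOfLE c hc b hle ?_ ?_, ?_⟩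
  · rintro r x ⟨-, hx⟩ h
    have := congrFun h e₀
    have hx' : x e₀ = 0 := hx
    simpa [hc₀, hx'] using this
  · intro z hz
    refine ⟨-z e₀, Submodule.add_mem _ hz (Submodule.smul_mem _ _ hc), ?_⟩
    change (z + (-z e₀) • c) e₀ = 0
    simp [hc₀]
  · funext l
    rw [Module.Basis.coe_mkFinConsOfLE]
    refine Fin.cases ?_ (fun l => ?_) l
    · rfl
    · rfl

lemma Bridgeless.exists_basis_ne_zero {G : FeynmanGraph V E} (h : G.Bridgeless)
    (b : Module.Basis (Fin L) ℤ G.cycles) (e : E) : ∃ l, (b l : E → ℤ) e ≠ 0 := by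
  by_contra! hb
  obtain ⟨c, hc, hce⟩ := h e
  have h1 := congrArg (fun x : G.cycles => (x : E → ℤ) e) (b.sum_repr ⟨c, hc⟩)
  simp only [Submodule.coe_sum, Finset.sum_apply, SetLike.val_smul, Pi.smul_apply, hb, smul_zero,
    Finset.sum_const_zero] at h1
  exact hce h1.symm

theorem isResidue_cutFunction {G : FeynmanGraph V E} (hG : G.Connected) (v₀ : V) (hd : 0 < d)
    (hbr : G.Bridgeless) (s : S → E × E) {e₀ : E} {c : E → ℤ} (hc : c ∈ G.cycles)
    (hc₀ : c e₀ = 1) (b : Module.Basis (Fin L) ℤ (G.cyclesAvoiding e₀)) {α : E → ℝ}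
    (hα : ∀ e, 0 < α e) (hsum : ∑ e, α e = ((L : ℝ) + 1) * d / 2 + Fintype.card S)
    {q₀ : EuclideanSpace ℝ (Fin d)} (h₀ : q₀ ≠ 0)
    (hi : Integrable (cutFunction s α e₀ c (fun l => (b l : E → ℤ)) q₀)) (T : Finset E) (f : E) :
    IntegrableOn (fun x => G.weightedIntegrand v₀ d s α (fillSlice T f x)) (slice T f) ∧
      IsResidue (d := d) (cutFunction s α e₀ c (fun l => (b l : E → ℤ))) (α e₀)
        (G.parametricResidue v₀ d s α T f) := by
  obtain ⟨B, hB⟩ := exists_basis_cycles hc hc₀ b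
  obtain ⟨C, C', hC⟩ := integrable_cutFunction hsum h₀ hi
  have hb₀ : ∀ l, (b l : E → ℤ) e₀ = 0 := fun l => (b l).2.2
  obtain ⟨h1, h2⟩ := integral_cutWeight hd hc₀ hb₀ (hα e₀) hC
  rw [← hB] at h1 h2
  obtain ⟨h3, h4⟩ := integral_weightedIntegrand hG v₀ hd s B (hbr.exists_basis_ne_zero B) hα e₀ h1
  obtain ⟨h5, h6⟩ := integral_slice_of_homogeneous T f e₀
    (measurable_weightedIntegrand (d := d) G v₀ s α)
    (fun a ha r hr => weightedIntegrand_smul hG v₀ hd s B (by rw [hsum]; push_cast; rfl) ha hr) h3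
  refine ⟨h5, fun q hq => ⟨(hC q hq).1, ?_⟩⟩
  have hΓ : 0 < Real.Gamma ((d : ℝ) / 2) := Real.Gamma_pos_of_pos (by positivity)
  rw [(hC q hq).2.1, parametricResidue, h6, h4, h2]
  -- The vacuum diagram has `L + 1` loops; the `π^(d/2)` from the radial integral cancels the
  -- normalization of the additional one.
  have h7 : Real.pi ^ (-(((L + 1 : ℕ) : ℝ) * d / 2)) * Real.pi ^ ((d : ℝ) / 2) =
      Real.pi ^ (-((L : ℝ) * d / 2)) := by
    rw [← Real.rpow_add Real.pi_pos]
    congr 1; push_cast; ring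
  rw [← h7]
  field_simp

end Residue

/-! ### Propagator graphs through their completion -/

section Completed

variable {d L : ℕ}

lemma Connected.completed {G : FeynmanGraph V E} (hG : G.Connected) (u w : V) :
    (G.completed u w).Connected := fun x y =>
  (hG x y).mono fun _ _ ⟨e, h⟩ => ⟨some e, h⟩

/-- A cycle of the completed graph is a flow in `G` from `u` to `w` whose strength returns through
the new edge. -/
lemma mem_cycles_completed {G : FeynmanGraph V E} {u w : V} {c : Option E → ℤ} :
    c ∈ (G.completed u w).cycles ↔ ∀ v, ∑ e, G.incidence e v * c (some e) =
      ((if w = v then 1 else 0) - (if u = v then 1 else 0)) * c none := by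
  rw [mem_cycles]
  refine forall_congr' fun v => ?_
  rw [Fintype.sum_option]
  have h1 : (G.completed u w).incidence none v =
      (if u = v then 1 else 0) - (if w = v then 1 else 0) := rfl
  have h2 : ∀ e, (G.completed u w).incidence (some e) v = G.incidence e v := fun _ => rfl
  simp only [h1, h2]
  constructor <;> intro h <;> linear_combination h

/-- The cycles of the completed graph that avoid the new edge. -/
def cyclesAvoidingNoneEquiv (G : FeynmanGraph V E) (u w : V) :
    G.cycles ≃ₗ[ℤ] (G.completed u w).cyclesAvoiding none where
  toFun c := ⟨fun o => o.elim 0 c.1, by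
    refine ⟨mem_cycles_completed.2 fun v => ?_, rfl⟩
    simpa using mem_cycles.1 c.2 v⟩
  map_add' c c' := by
    ext o
    cases o <;> simp
  map_smul' r c := by
    ext o
    cases o <;> simp
  invFun c := ⟨fun e => c.1 (some e), by
    rw [mem_cycles]
    intro v
    have h0 : c.1 none = 0 := c.2.2
    simpa [h0] using mem_cycles_completed.1 c.2.1 v⟩
  left_inv c := rfl
  right_inv c := by
    ext o
    cases o
    · exact c.2.2.symm
    · rfl

lemma routedMomentum_completed (c : E → ℤ) (b : Fin L → E → ℤ) (q : EuclideanSpace ℝ (Fin d))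
    (k : Fin L → EuclideanSpace ℝ (Fin d)) :
    routedMomentum (fun o : Option E => o.elim 1 c) (fun l o => o.elim 0 (b l)) q k =
      fun o => o.elim q (routedMomentum c b q k) := by
  funext o
  cases o <;> simp [routedMomentum]

/-- The new edge carries `q` and, being cut, no propagator; so `α₀` can be any number here. -/
lemma propagatorFunction_eq_cutFunction (s : S → Option E × Option E) (α : E → ℝ) (α₀ : ℝ)
    (c : E → ℤ) (b : Fin L → E → ℤ) :
    propagatorFunction (d := d) s α c b =
      cutFunction s (fun o => o.elim α₀ α) none (fun o : Option E => o.elim 1 c)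
        (fun l o => o.elim 0 (b l)) := by
  funext q k
  have h : (Finset.univ.erase none : Finset (Option E)) =
      Finset.univ.map Function.Embedding.some := by
    ext o
    cases o <;> simp
  rw [propagatorFunction, cutFunction, routedMomentum_completed, h, Finset.prod_map]
  rfl

theorem isResidue_propagatorFunction {G : FeynmanGraph V E} (hG : G.Connected) (v₀ : V)
    (hd : 0 < d) {u w : V} (hbr : (G.completed u w).Bridgeless) (s : S → Option E × Option E)
    {c : E → ℤ} (hc : ∀ v, ∑ e, G.incidence e v * c e =
      (if v = w then 1 else 0) - (if v = u then 1 else 0))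
    (b : Module.Basis (Fin L) ℤ G.cycles) {α : E → ℝ} {α₀ : ℝ} (hα : ∀ e, 0 < α e) (hα₀ : 0 < α₀)
    (hsum : α₀ + ∑ e, α e = ((L : ℝ) + 1) * d / 2 + Fintype.card S)
    {q₀ : EuclideanSpace ℝ (Fin d)} (h₀ : q₀ ≠ 0)
    (hi : Integrable (propagatorFunction s α c (fun l => (b l : E → ℤ)) q₀))
    (T : Finset (Option E)) (f : Option E) :
    IntegrableOn (fun x => (G.completed u w).weightedIntegrand v₀ d s (fun o => o.elim α₀ α)
        (fillSlice T f x)) (slice T f) ∧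
      IsResidue (d := d) (propagatorFunction s α c (fun l => (b l : E → ℤ))) α₀
        ((G.completed u w).parametricResidue v₀ d s (fun o => o.elim α₀ α) T f) := by
  rw [propagatorFunction_eq_cutFunction s α α₀] at hi ⊢
  refine isResidue_cutFunction (hG.completed u w) v₀ hd hbr s (e₀ := none)
    (c := fun o => o.elim 1 c) (α := fun o => o.elim α₀ α) ?_ rfl
    (b.map (cyclesAvoidingNoneEquiv G u w)) ?_ ?_ h₀ hi T f
  · refine mem_cycles_completed.2 fun v => ?_
    simpa [eq_comm] using hc v
  · rintro (_ | e)
    · exact hα₀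
    · exact hα e
  · rw [Fintype.sum_option]
    exact hsum

end Completed

end FeynmanGraph

theorem theorem1 {V E S : Type*} [Fintype V] [DecidableEq V] [Fintype E] [DecidableEq E]
    [Fintype S] [DecidableEq S] (d : ℕ) (hd : 0 < d) (G : FeynmanGraph V E) (hG : G.Connected)
    (v₀ : V) :
    -- the integrand of a vacuum diagram
    (∀ (s : S → E × E) (L : ℕ) (b : Module.Basis (Fin L) ℤ G.cycles) (a : E → ℝ),
      (∀ e, 0 < a e) →
      Integrable (FeynmanGraph.schwingerFunction (d := d) s (fun l => (b l : E → ℤ)) a) ∧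
      FeynmanGraph.vacuumIntegrand d s (fun l => (b l : E → ℤ)) a =
        G.parametricIntegrand v₀ d s a) ∧
    -- the residue of a vacuum diagram, cut at any of its edges
    (G.Bridgeless →
      ∀ (s : S → E × E) (e₀ : E) (c : E → ℤ), c ∈ G.cycles → c e₀ = 1 →
      ∀ (L : ℕ) (b : Module.Basis (Fin L) ℤ (G.cyclesAvoiding e₀)) (α : E → ℝ),
      (∀ e, 0 < α e) →
      ∑ e, α e = ((L : ℝ) + 1) * d / 2 + Fintype.card S →
      (∃ q : EuclideanSpace ℝ (Fin d), q ≠ 0 ∧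
        Integrable (FeynmanGraph.cutFunction s α e₀ c (fun l => (b l : E → ℤ)) q)) →
      ∀ (T : Finset E) (f : E), f ∈ T →
        IntegrableOn
          (fun x => G.weightedIntegrand v₀ d s α (FeynmanGraph.fillSlice T f x))
          (FeynmanGraph.slice T f) ∧
        FeynmanGraph.IsResidue (d := d)
          (FeynmanGraph.cutFunction s α e₀ c (fun l => (b l : E → ℤ))) (α e₀)
          (G.parametricResidue v₀ d s α T f)) ∧
    -- the residue of a propagator graph, through its completed graph
    (∀ u w : V, (G.completed u w).Bridgeless →
      ∀ (s : S → Option E × Option E) (c : E → ℤ),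
      (∀ v, ∑ e, G.incidence e v * c e = (if v = w then 1 else 0) - (if v = u then 1 else 0)) →
      ∀ (L : ℕ) (b : Module.Basis (Fin L) ℤ G.cycles) (α : E → ℝ) (α₀ : ℝ),
      (∀ e, 0 < α e) → 0 < α₀ →
      α₀ + ∑ e, α e = ((L : ℝ) + 1) * d / 2 + Fintype.card S →
      (∃ q : EuclideanSpace ℝ (Fin d), q ≠ 0 ∧
        Integrable (FeynmanGraph.propagatorFunction s α c (fun l => (b l : E → ℤ)) q)) →
      ∀ (T : Finset (Option E)) (f : Option E), f ∈ T →
        IntegrableOn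
          (fun x => (G.completed u w).weightedIntegrand v₀ d s (fun o => o.elim α₀ α)
            (FeynmanGraph.fillSlice T f x))
          (FeynmanGraph.slice T f) ∧
        FeynmanGraph.IsResidue (d := d)
          (FeynmanGraph.propagatorFunction s α c (fun l => (b l : E → ℤ))) α₀
          ((G.completed u w).parametricResidue v₀ d s (fun o => o.elim α₀ α) T f)) := by
  refine ⟨fun s L b a ha => ⟨FeynmanGraph.integrable_schwingerFunction hG s b v₀ ha,
    FeynmanGraph.vacuumIntegrand_eq_parametricIntegrand hG hd s b v₀ ha⟩, ?_, ?_⟩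
  · rintro hbr s e₀ c hc hc₀ L b α hα hsum ⟨q₀, h₀, hi⟩ T f -
    exact FeynmanGraph.isResidue_cutFunction hG v₀ hd hbr s hc hc₀ b hα hsum h₀ hi T f
  · rintro u w hbr s c hc L b α α₀ hα hα₀ hsum ⟨q₀, h₀, hi⟩ T f -
    exact FeynmanGraph.isResidue_propagatorFunction hG v₀ hd hbr s hc b hα hα₀ hsum h₀ hi T f
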